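/- An instance of unweighted, complete correlation clustering is a complete graph on a set $V$ of $n$ vertices in which every edge is labelled positive or negative. A clustering $\mathcal C$ is a partition of $V$; a positive edge is a disagreement if its endpoints lie in different clusters, and a negative edge is a disagreement if its endpoints lie in the same cluster. Let $y_{\mathcal C}(u)$ be the number of disagreements incident to $u$, and for $p\in[1,\infty]$ let the $\ell_p$-norm objective of $\mathcal C$ be $\lVert y_{\mathcal C}\rVert_p$. Let $\Delta$ denote the maximum positive degree, where each vertex is counted as having a positive self-loop (so $\Delta\ge 1$ if $n\ge 1$). There are absolute constants $K$, $C$, $k$ and a single deterministic algorithm on a word RAM (unit-cost addition, truncated subtraction, multiplication, integer division, comparisons and indirect array access on words that hold the numbers below $(n+2)^k$, i.e. words of $O(\log n)$ bits for $n\ge 2$) such that the following holds for every instance. Given $n$ and an adjacency list representation of the positive edges (for each vertex, its positive neighbours in an arbitrary order), the algorithm halts after at most $C\,(n\Delta^2\log n+1)$ steps, hence in time $O(n\Delta^2\log n)$ for $n\ge 2$, and returns one clustering $\mathcal C^*$ that is simultaneously a $K$-approximation for all $\ell_p$-norm objectives: $$\lVert y_{\mathcal C^*}\rVert_p\le K\,\lVert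 y_{\mathcal C}\rVert_p\qquad\text{for every clustering }\mathcal C\text{ and every }p\in[1,\infty].$$ -/

import Mathlib

/-! ## A word RAM

Programs act on finitely many named registers and finitely many named arrays of words, all
initially zero apart from the input. Every primitive instruction and every evaluation of a
test costs one time step. A word is a natural number below a bound `W`; a computation whose
next instruction would produce a number that does not fit in a word is stuck. -/

namespace WordRAM

/-- The arithmetic operations on words; subtraction is truncated at zero and division is
integer division, with `a / 0 = 0`. -/
inductive Op where
  | add
  | sub
  | mul
  | div

/-- The value of an arithmetic operation. -/
def Op.eval : Op → ℕ → ℕ → ℕ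
  | .add, a, b => a + b
  | .sub, a, b => a - b
  | .mul, a, b => a * b
  | .div, a, b => a / b

/-- Tests comparing the contents of two registers. -/
inductive Test where
  | lt (x y : ℕ)
  | le (x y : ℕ)
  | eq (x y : ℕ)
  | ne (x y : ℕ)

/-- A state: the contents of the registers, and of the cells of the arrays
(`arr a i` is cell `i` of array `a`). -/
structure State where
  reg : ℕ → ℕ
  arr : ℕ → ℕ → ℕ

/-- Write `v` into register `x`. -/
def State.setReg (s : State) (x v : ℕ) : State :=
  { s with reg := Function.update s.reg x v }

/-- Write `v` into cell `i` of array `a`. -/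
def State.setArr (s : State) (a i v : ℕ) : State :=
  { s with arr := Function.update s.arr a (Function.update (s.arr a) i v) }

/-- The truth of a test in a state. -/
def Test.holds (s : State) : Test → Prop
  | .lt x y => s.reg x < s.reg y
  | .le x y => s.reg x ≤ s.reg y
  | .eq x y => s.reg x = s.reg y
  | .ne x y => s.reg x ≠ s.reg y

/-- Programs. The names of registers (`x`, `y`, `z`, `i`) and of arrays (`a`) are constants of
the program text; array cells are addressed by the contents of a register. -/
inductive Program where
  /-- do nothing -/
  | skip
  /-- `x := c` for a constant `c` -/
  | const (x c : ℕ)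
  /-- `x := y` -/
  | copy (x y : ℕ)
  /-- `x := y o z` -/
  | arith (o : Op) (x y z : ℕ)
  /-- `x := a[i]` -/
  | load (x a i : ℕ)
  /-- `a[i] := x` -/
  | store (a i x : ℕ)
  /-- sequential composition -/
  | seq (p q : Program)
  /-- if `b` then `p` else `q` -/
  | cond (b : Test) (p q : Program)
  /-- while `b` do `p` -/
  | loop (b : Test) (p : Program)

/-- `Exec W p s T s'`: with words bounded by `W`, the program `p` started in the state `s`
halts in the state `s'` after exactly `T` time steps, without ever overflowing a word. -/
inductive Exec (W : ℕ) : Program → State → ℕ → State → Prop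
  | skip (s : State) : Exec W .skip s 1 s
  | const (s : State) (x c : ℕ) (h : c < W) :
      Exec W (.const x c) s 1 (s.setReg x c)
  | copy (s : State) (x y : ℕ) (h : s.reg y < W) :
      Exec W (.copy x y) s 1 (s.setReg x (s.reg y))
  | arith (s : State) (o : Op) (x y z : ℕ) (h : o.eval (s.reg y) (s.reg z) < W) :
      Exec W (.arith o x y z) s 1 (s.setReg x (o.eval (s.reg y) (s.reg z)))
  | load (s : State) (x a i : ℕ) (hi : s.reg i < W) (h : s.arr a (s.reg i) < W) :
      Exec W (.load x a i) s 1 (s.setReg x (s.arr a (s.reg i)))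
  | store (s : State) (a i x : ℕ) (hi : s.reg i < W) (h : s.reg x < W) :
      Exec W (.store a i x) s 1 (s.setArr a (s.reg i) (s.reg x))
  | seq {p q : Program} {s s' s'' : State} {T T' : ℕ}
      (h : Exec W p s T s') (h' : Exec W q s' T' s'') :
      Exec W (.seq p q) s (T + T') s''
  | cond_true {b : Test} {p q : Program} {s s' : State} {T : ℕ}
      (hb : b.holds s) (h : Exec W p s T s') :
      Exec W (.cond b p q) s (1 + T) s'
  | cond_false {b : Test} {p q : Program} {s s' : State} {T : ℕ}
      (hb : ¬ b.holds s) (h : Exec W q s T s') :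
      Exec W (.cond b p q) s (1 + T) s'
  | loop_false {b : Test} {p : Program} {s : State} (hb : ¬ b.holds s) :
      Exec W (.loop b p) s 1 s
  | loop_true {b : Test} {p : Program} {s s' s'' : State} {T T' : ℕ}
      (hb : b.holds s) (h : Exec W p s T s') (h' : Exec W (.loop b p) s' T' s'') :
      Exec W (.loop b p) s (1 + T + T') s''

end WordRAM

/-! ## Correlation clustering

An instance of unweighted, complete correlation clustering on the vertex set `Fin n` is given by
the simple graph `G` of its positive edges: a pair of distinct vertices is a positive edge if it
is adjacent in `G`, and a negative edge otherwise. A clustering is a partition of the vertices,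
that is, an equivalence relation whose classes are the clusters. -/

namespace CorrClust

open Classical in
/-- The positive neighbourhood of `u`; every vertex has a positive self-loop. -/
noncomputable def posNbhd {n : ℕ} (G : SimpleGraph (Fin n)) (u : Fin n) : Finset (Fin n) :=
  Finset.univ.filter fun v => v = u ∨ G.Adj u v

/-- The maximum positive degree, where the positive self-loops count. -/
noncomputable def maxPosDegree {n : ℕ} (G : SimpleGraph (Fin n)) : ℕ :=
  Finset.univ.sup fun u => (posNbhd G u).card

open Classical in
/-- The disagreement vector of the clustering `C`: the number of vertices `v` such that `uv` is
either a positive edge between different clusters or a negative edge inside a cluster. -/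
noncomputable def disagreement {n : ℕ} (G : SimpleGraph (Fin n)) (C : Setoid (Fin n))
    (u : Fin n) : ℕ :=
  (Finset.univ.filter fun v =>
    (v ∈ posNbhd G u ∧ ¬ C.r u v) ∨ (v ∉ posNbhd G u ∧ C.r u v)).card

/-- The objective value of a clustering: the `ℓ_p`-norm of its disagreement vector. -/
noncomputable def lpCost {n : ℕ} (G : SimpleGraph (Fin n)) (p : ENNReal)
    (C : Setoid (Fin n)) : ℝ :=
  ‖(WithLp.toLp p fun u => (disagreement G C u : ℝ) : PiLp p fun _ : Fin n => ℝ)‖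

/-- `adj` is an adjacency list representation of `G`: it lists the neighbours of each vertex
in some order, without repetition. -/
structure IsAdjList {n : ℕ} (G : SimpleGraph (Fin n)) (adj : Fin n → List (Fin n)) : Prop where
  nodup : ∀ u, (adj u).Nodup
  mem_iff : ∀ u v, v ∈ adj u ↔ G.Adj u v

/-- The initial state of the machine on the input `adj`. Register `0` holds `n`, array `1` holds
the `n` lists one after the other, and cell `i` of array `0` (for `0 ≤ i ≤ n`) holds the total
length of the first `i` lists, so that the list of vertex `u` occupies the cells of array `1`
from `arr 0 u` (inclusive) to `arr 0 (u + 1)` (exclusive). Everything else is zero. -/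
def inputState {n : ℕ} (adj : Fin n → List (Fin n)) : WordRAM.State where
  reg := fun x => if x = 0 then n else 0
  arr := fun a i =>
    if a = 0 then (if i ≤ n then ((List.ofFn adj).take i).flatten.length else 0)
    else if a = 1 then ((List.ofFn adj).flatten.map Fin.val).getD i 0
    else 0

/-- The clustering written in array `2`: cell `u` holds the label of the cluster of vertex `u`,
and two vertices are in the same cluster if they have the same label. -/
def outputClustering (n : ℕ) (s : WordRAM.State) : Setoid (Fin n) :=
  Setoid.ker fun u : Fin n => s.arr 2 u

end CorrClust

/-! Write d for the positive degree with self-loop. Two vertices agree if their positive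
neighbourhoods share at least nine tenths of each. A vertex is heavy if it agrees with at least nine
tenths of its neighbours. Two heavy vertices are linked if some vertex is a positive neighbour of
both and agrees with both. The overlaps are so large that linking is transitive (`Linked.trans`), so
the classes of linked vertices, together with singletons, form a clustering that can be recognised
locally.

Let y be the disagreement vector of an arbitrary clustering. Separating two vertices costs their
common neighbours, and joining them costs the difference of their neighbourhoods. Hence if a pair
joined by that clustering does not agree, or a linked pair is separated by it, y(u) + y(v) is at
least a constant fraction of max(d(u), d(v)). Charging each bad pair to (y(u) + y(v)) / max(d(u),
d(v)) bounds the disagreements of the linked clustering pointwise by y and by averages of y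
(`lossDeg_le`, `card_cut_le`, `card_joined_le`). The averaging kernel is symmetric with bounded row
sums, so the Schur test `lpNorm_sum_mul_le` bounds it on every ℓ_p at once; `lpCost_le_of_linked`
collects the constants.

For the running time, intersecting the list of u with those of its neighbours costs O(Δ²) per
vertex. The smallest vertex linked to a heavy u is found by two rounds of minima over agreeing
neighbours, and transitivity makes it a label of the class (`IsLabelling.label_eq_iff`). The total
is O(nΔ²), without the logarithm. -/

namespace CorrClust

/-! ### Norms of vectors and the Schur test -/

/-- The `ℓ_p`-norm of a real vector. -/
noncomputable def lpNorm {n : ℕ} (p : ENNReal) (f : Fin n → ℝ) : ℝ :=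
  ‖(WithLp.toLp p f : PiLp p fun _ : Fin n => ℝ)‖

lemma lpNorm_add_le {n : ℕ} {p : ENNReal} (hp : 1 ≤ p) (f g : Fin n → ℝ) :
    lpNorm p (f + g) ≤ lpNorm p f + lpNorm p g := by
  have : Fact (1 ≤ p) := ⟨hp⟩
  unfold lpNorm
  rw [WithLp.toLp_add]
  exact norm_add_le _ _

lemma lpNorm_smul {n : ℕ} {p : ENNReal} (hp : 1 ≤ p) {c : ℝ} (hc : 0 ≤ c) (f : Fin n → ℝ) :
    lpNorm p (c • f) = c * lpNorm p f := by
  have : Fact (1 ≤ p) := ⟨hp⟩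
  unfold lpNorm
  rw [WithLp.toLp_smul, norm_smul, Real.norm_of_nonneg hc]

lemma lpNorm_top {n : ℕ} (f : Fin n → ℝ) : lpNorm ⊤ f = ⨆ i, |f i| := rfl

lemma lpNorm_of_ne_top {n : ℕ} {p : ENNReal} (hp : 1 ≤ p) (hp' : p ≠ ⊤) (f : Fin n → ℝ) :
    lpNorm p f = (∑ i, |f i| ^ p.toReal) ^ (1 / p.toReal) :=
  PiLp.norm_eq_sum (ENNReal.toReal_pos (by positivity) hp') _

lemma lpNorm_mono {n : ℕ} {p : ENNReal} (hp : 1 ≤ p) {f g : Fin n → ℝ} (hf : ∀ u, 0 ≤ f u)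
    (hfg : ∀ u, f u ≤ g u) : lpNorm p f ≤ lpNorm p g := by
  have habs : ∀ u, |f u| ≤ |g u| := fun u => by
    rw [abs_of_nonneg (hf u), abs_of_nonneg ((hf u).trans (hfg u))]; exact hfg u
  by_cases hp' : p = ⊤
  · subst hp'
    rw [lpNorm_top, lpNorm_top]
    exact ciSup_mono (Set.finite_range _).bddAbove habs
  · rw [lpNorm_of_ne_top hp hp', lpNorm_of_ne_top hp hp']
    have := ENNReal.toReal_pos (by positivity) hp'
    refine Real.rpow_le_rpow (Finset.sum_nonneg fun i _ => by positivity)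
      (Finset.sum_le_sum fun i _ => ?_) (by positivity)
    exact Real.rpow_le_rpow (abs_nonneg _) (habs i) this.le

/-- The Schur test: a nonnegative matrix whose row and column sums are at most `a` has norm at
most `a` on `ℓ_p`. -/
lemma lpNorm_sum_mul_le {n : ℕ} {p : ENNReal} (hp : 1 ≤ p) {M : Fin n → Fin n → ℝ} {a : ℝ}
    (ha : 0 ≤ a) (hM : ∀ u v, 0 ≤ M u v) (hrow : ∀ u, ∑ v, M u v ≤ a)
    (hcol : ∀ v, ∑ u, M u v ≤ a) {f : Fin n → ℝ} (hf : ∀ u, 0 ≤ f u) :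
    lpNorm p (fun u => ∑ v, M u v * f v) ≤ a * lpNorm p f := by
  have hnn : ∀ u, 0 ≤ ∑ v, M u v * f v := fun u =>
    Finset.sum_nonneg fun v _ => mul_nonneg (hM u v) (hf v)
  by_cases hp' : p = ⊤
  · subst hp'
    rw [lpNorm_top, lpNorm_top]
    refine Real.iSup_le (fun u => ?_)
      (mul_nonneg ha (Real.iSup_nonneg fun u => abs_nonneg _))
    rw [abs_of_nonneg (hnn u)]
    have hle : ∀ v, f v ≤ ⨆ i, |f i| := fun v =>
      (le_abs_self _).trans (le_ciSup (f := fun i => |f i|) (Set.finite_range _).bddAbove v)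
    calc ∑ v, M u v * f v ≤ ∑ v, M u v * ⨆ i, |f i| :=
          Finset.sum_le_sum fun v _ => mul_le_mul_of_nonneg_left (hle v) (hM u v)
      _ = (∑ v, M u v) * ⨆ i, |f i| := by rw [Finset.sum_mul]
      _ ≤ _ := mul_le_mul_of_nonneg_right (hrow u) (Real.iSup_nonneg fun u => abs_nonneg _)
  · rw [lpNorm_of_ne_top hp hp', lpNorm_of_ne_top hp hp']
    have hq : 1 ≤ p.toReal := by
      rw [← ENNReal.toReal_one]; exact ENNReal.toReal_mono hp' hp
    set q := p.toReal
    have hq0 : 0 < q := by linarith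
    -- Hölder with weights `M u` is Jensen's inequality for the q-th power. The row sums enter with
    -- exponent q - 1, and the column sums supply the last factor a after summation over u.
    have hpt : ∀ u, (∑ v, M u v * f v) ^ q ≤ a ^ (q - 1) * ∑ v, M u v * f v ^ q := by
      intro u
      have h1 := Real.inner_le_weight_mul_Lp_of_nonneg Finset.univ hq (M u) f (hM u) hf
      have hs : 0 ≤ ∑ v, M u v := Finset.sum_nonneg fun v _ => hM u v
      have hs' : 0 ≤ ∑ v, M u v * f v ^ q :=
        Finset.sum_nonneg fun v _ => mul_nonneg (hM u v) (Real.rpow_nonneg (hf v) _)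
      calc (∑ v, M u v * f v) ^ q
          ≤ ((∑ v, M u v) ^ (1 - q⁻¹) * (∑ v, M u v * f v ^ q) ^ q⁻¹) ^ q :=
            Real.rpow_le_rpow (hnn u) h1 hq0.le
        _ = (∑ v, M u v) ^ (q - 1) * ∑ v, M u v * f v ^ q := by
            rw [Real.mul_rpow (Real.rpow_nonneg hs _) (Real.rpow_nonneg hs' _),
              ← Real.rpow_mul hs, ← Real.rpow_mul hs', inv_mul_cancel₀ hq0.ne', Real.rpow_one,
              sub_mul, inv_mul_cancel₀ hq0.ne', one_mul]
        _ ≤ _ := by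
            have := hrow u
            have h2 : 0 ≤ q - 1 := by linarith
            gcongr
    have hsum : ∑ u, |∑ v, M u v * f v| ^ q ≤ a ^ q * ∑ v, |f v| ^ q := by
      calc ∑ u, |∑ v, M u v * f v| ^ q ≤ ∑ u, a ^ (q - 1) * ∑ v, M u v * f v ^ q :=
            Finset.sum_le_sum fun u _ => by rw [abs_of_nonneg (hnn u)]; exact hpt u
        _ = a ^ (q - 1) * ∑ v, (∑ u, M u v) * f v ^ q := by
            rw [← Finset.mul_sum, Finset.sum_comm]
            simp_rw [Finset.sum_mul]
        _ ≤ a ^ (q - 1) * ∑ v, a * f v ^ q := by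
            gcongr with v
            · exact Real.rpow_nonneg (hf v) _
            · exact hcol v
        _ = a ^ q * ∑ v, |f v| ^ q := by
            rw [← Finset.mul_sum, ← mul_assoc]
            congr 1
            -- The exponent law needs a nonzero base; for a = 0 both sides vanish because q > 0.
            · rcases ha.eq_or_lt with rfl | ha
              · rw [mul_zero, Real.zero_rpow hq0.ne']
              · rw [← Real.rpow_add_one ha.ne', sub_add_cancel]
            · exact Finset.sum_congr rfl fun v _ => by rw [abs_of_nonneg (hf v)]
    calc (∑ u, |∑ v, M u v * f v| ^ q) ^ (1 / q) ≤ (a ^ q * ∑ v, |f v| ^ q) ^ (1 / q) := by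
          gcongr
      _ = a * (∑ v, |f v| ^ q) ^ (1 / q) := by
          rw [Real.mul_rpow (Real.rpow_nonneg ha _)
            (Finset.sum_nonneg fun v _ => Real.rpow_nonneg (abs_nonneg _) _),
            ← Real.rpow_mul ha, mul_one_div_cancel hq0.ne', Real.rpow_one]

/-! ### Agreement, heavy vertices and the linking relation -/

section Agreement

variable {n : ℕ} {G : SimpleGraph (Fin n)} {u v w : Fin n}

lemma mem_posNbhd : v ∈ posNbhd G u ↔ v = u ∨ G.Adj u v := by
  simp [posNbhd]

lemma self_mem_posNbhd : u ∈ posNbhd G u := mem_posNbhd.2 (.inl rfl)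

lemma mem_posNbhd_comm : v ∈ posNbhd G u ↔ u ∈ posNbhd G v := by
  rw [mem_posNbhd, mem_posNbhd, eq_comm, G.adj_comm]

variable (G) in
/-- The positive degree, counting the self-loop. -/
noncomputable def posDeg (u : Fin n) : ℕ := (posNbhd G u).card

variable (G) in
/-- The number of common positive neighbours. -/
noncomputable def commonDeg (u v : Fin n) : ℕ := (posNbhd G u ∩ posNbhd G v).card

lemma posDeg_pos : 0 < posDeg G u := Finset.card_pos.2 ⟨u, self_mem_posNbhd⟩

lemma posDeg_le_maxPosDegree : posDeg G u ≤ maxPosDegree G :=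
  Finset.le_sup (f := fun u => (posNbhd G u).card) (Finset.mem_univ u)

lemma commonDeg_comm : commonDeg G u v = commonDeg G v u := by
  rw [commonDeg, Finset.inter_comm, commonDeg]

lemma commonDeg_self : commonDeg G u u = posDeg G u := by
  rw [commonDeg, Finset.inter_self, posDeg]

lemma commonDeg_le_left : commonDeg G u v ≤ posDeg G u :=
  Finset.card_le_card Finset.inter_subset_left

lemma commonDeg_le_right : commonDeg G u v ≤ posDeg G v :=
  Finset.card_le_card Finset.inter_subset_right

lemma posDeg_le_card : posDeg G u ≤ n :=
  (Finset.card_le_univ _).trans_eq (Fintype.card_fin n)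

/-- Inclusion-exclusion inside Z. It plays the role of a triangle inequality: two sets that each
cover most of Z overlap in Z. -/
lemma card_inter_add_card_inter_le (X Y Z : Finset (Fin n)) :
    (X ∩ Z).card + (Z ∩ Y).card ≤ Z.card + (X ∩ Z ∩ (Z ∩ Y)).card := by
  rw [← Finset.card_union_add_card_inter]
  gcongr
  exact Finset.union_subset Finset.inter_subset_right Finset.inter_subset_left

variable (G) in
/-- Two vertices agree if their positive neighbourhoods are nearly equal. -/
def Agree (u v : Fin n) : Prop :=
  9 * posDeg G u ≤ 10 * commonDeg G u v ∧ 9 * posDeg G v ≤ 10 * commonDeg G u v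

lemma Agree.symm (h : Agree G u v) : Agree G v u := by
  rw [Agree, commonDeg_comm]; exact ⟨h.2, h.1⟩

lemma agree_self : Agree G u u := by
  rw [Agree, commonDeg_self]; omega

variable (G) in
open Classical in
/-- The positive neighbours with which a vertex agrees. -/
noncomputable def agreeNbhd (u : Fin n) : Finset (Fin n) :=
  (posNbhd G u).filter fun v => Agree G u v

lemma mem_agreeNbhd : v ∈ agreeNbhd G u ↔ v ∈ posNbhd G u ∧ Agree G u v := by
  simp [agreeNbhd]

lemma agreeNbhd_subset : agreeNbhd G u ⊆ posNbhd G u :=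
  fun _ hv => (mem_agreeNbhd.1 hv).1

lemma self_mem_agreeNbhd : u ∈ agreeNbhd G u := mem_agreeNbhd.2 ⟨self_mem_posNbhd, agree_self⟩

lemma mem_agreeNbhd_comm : v ∈ agreeNbhd G u ↔ u ∈ agreeNbhd G v := by
  rw [mem_agreeNbhd, mem_agreeNbhd, mem_posNbhd_comm]
  exact and_congr_right fun _ => ⟨Agree.symm, Agree.symm⟩

variable (G) in
/-- The number of positive neighbours with which a vertex does not agree. -/
noncomputable def lossDeg (u : Fin n) : ℕ := (posNbhd G u \ agreeNbhd G u).card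

lemma lossDeg_add : lossDeg G u + (agreeNbhd G u).card = posDeg G u :=
  Finset.card_sdiff_add_card_eq_card agreeNbhd_subset

variable (G) in
/-- A vertex is heavy if it agrees with nearly all its positive neighbours. -/
def Heavy (u : Fin n) : Prop := 9 * posDeg G u ≤ 10 * (agreeNbhd G u).card

lemma Heavy.lossDeg_le (h : Heavy G u) : 10 * lossDeg G u ≤ posDeg G u := by
  have := lossDeg_add (G := G) (u := u)
  rw [Heavy] at h
  omega

lemma posDeg_le_of_not_heavy (h : ¬ Heavy G u) : posDeg G u ≤ 10 * lossDeg G u := by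
  have := lossDeg_add (G := G) (u := u)
  rw [Heavy] at h
  omega

variable (G) in
/-- Two heavy vertices are linked if they agree with a common neighbour. -/
def Linked (u v : Fin n) : Prop :=
  Heavy G u ∧ Heavy G v ∧ ∃ w, w ∈ agreeNbhd G u ∧ w ∈ agreeNbhd G v

lemma Linked.symm (h : Linked G u v) : Linked G v u := by
  obtain ⟨hu, hv, w, h1, h2⟩ := h
  exact ⟨hv, hu, w, h2, h1⟩

/-- Through the common agreeing neighbour w, the overlap of u and v is at least c(u,w) + c(w,v) -
d(w), where c counts common neighbours. As c(w,v) ≥ 9/10 d(w) and d(w) ≤ 10/9 c(u,w), this is at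
least 8/9 c(u,w) ≥ 4/5 d(u); symmetrically for v. The ratio 7/9 is slightly weaker. -/
lemma Linked.le_commonDeg (h : Linked G u v) :
    7 * posDeg G u ≤ 9 * commonDeg G u v ∧ 7 * posDeg G v ≤ 9 * commonDeg G u v := by
  obtain ⟨-, -, w, h1, h2⟩ := h
  obtain ⟨a1, a2⟩ := (mem_agreeNbhd.1 h1).2
  obtain ⟨b1, b2⟩ := (mem_agreeNbhd.1 h2).2.symm
  have h3 := card_inter_add_card_inter_le (posNbhd G u) (posNbhd G v) (posNbhd G w)
  have h4 : (posNbhd G u ∩ posNbhd G w ∩ (posNbhd G w ∩ posNbhd G v)).card ≤ commonDeg G u v :=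
    Finset.card_le_card fun x => by simp only [Finset.mem_inter]; tauto
  change commonDeg G u w + commonDeg G w v ≤ posDeg G w + _ at h3
  have := commonDeg_le_left (G := G) (u := u) (v := w)
  have := commonDeg_le_right (G := G) (u := w) (v := v)
  omega

/-- At least 5/9 of N(v) lies in all three neighbourhoods. If u and w had no common agreeing
neighbour, each of these vertices would be lost by u or by w, and they lose at most (d(u) + d(w))/10
≤ 18/70 d(v) in total, which is too few. -/
lemma Linked.trans (h : Linked G u v) (h' : Linked G v w) : Linked G u w := by
  refine ⟨h.1, h'.2.1, ?_⟩
  by_contra! hne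
  have h3 := card_inter_add_card_inter_le (posNbhd G u) (posNbhd G w) (posNbhd G v)
  change commonDeg G u v + commonDeg G v w ≤ posDeg G v + _ at h3
  have h4 : (posNbhd G u ∩ posNbhd G v ∩ (posNbhd G v ∩ posNbhd G w)).card ≤
      lossDeg G u + lossDeg G w := by
    refine (Finset.card_le_card fun x hx => ?_).trans (Finset.card_union_le _ _)
    have := hne x
    simp only [Finset.mem_inter, Finset.mem_union, Finset.mem_sdiff] at hx ⊢
    tauto
  have := h.le_commonDeg
  have := h'.le_commonDeg
  have := h.1.lossDeg_le
  have := h'.2.1.lossDeg_le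
  have := commonDeg_le_right (G := G) (u := u) (v := v)
  have := commonDeg_le_left (G := G) (u := v) (v := w)
  have := posDeg_pos (G := G) (u := v)
  omega

variable (G) in
open Classical in
/-- The vertices linked to a given vertex. -/
noncomputable def linkedSet (u : Fin n) : Finset (Fin n) := Finset.univ.filter (Linked G u)

lemma mem_linkedSet : v ∈ linkedSet G u ↔ Linked G u v := by simp [linkedSet]

/-- Double counting of the pairs (v, w) with v in S and w a common neighbour of u and v. -/
lemma sum_commonDeg (S : Finset (Fin n)) :
    ∑ v ∈ S, commonDeg G v u = ∑ w ∈ posNbhd G u, (S ∩ posNbhd G w).card := by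
  have h1 : ∀ v, commonDeg G v u = ∑ w ∈ posNbhd G u, if w ∈ posNbhd G v then 1 else 0 := by
    intro v
    rw [commonDeg, Finset.sum_boole, Finset.inter_comm, ← Finset.filter_mem_eq_inter, Nat.cast_id]
  simp_rw [h1]
  rw [Finset.sum_comm]
  refine Finset.sum_congr rfl fun w _ => ?_
  simp_rw [mem_posNbhd_comm (u := _) (v := w)]
  rw [Finset.sum_boole, ← Finset.filter_mem_eq_inter, Nat.cast_id]

/-- Each linked v shares at least 7/9 d(u) neighbours with u. Counted from the shared neighbours w
instead, an agreeing w sees at most d(w) ≤ 10/9 d(u) linked vertices, and each of the at most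
d(u)/10 lost ones sees at most |S|. Together 61 |S| ≤ 100 d(u). -/
lemma card_linkedSet_le : (linkedSet G u).card ≤ 2 * posDeg G u := by
  by_cases hu : Heavy G u
  swap
  · have : linkedSet G u = ∅ := by
      ext v; simp only [mem_linkedSet, Finset.notMem_empty, iff_false]; exact fun h => hu h.1
    simp [this]
  set S := linkedSet G u
  have h1 : S.card * (7 * posDeg G u) ≤ 9 * ∑ v ∈ S, commonDeg G v u := by
    rw [Finset.mul_sum, ← smul_eq_mul]
    exact Finset.card_nsmul_le_sum _ _ _ fun v hv => (mem_linkedSet.1 hv).symm.le_commonDeg.2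
  rw [sum_commonDeg, ← Finset.sum_sdiff agreeNbhd_subset] at h1
  have h2 : ∑ w ∈ posNbhd G u \ agreeNbhd G u, (S ∩ posNbhd G w).card ≤
      lossDeg G u * S.card := by
    rw [lossDeg, ← smul_eq_mul]
    exact Finset.sum_le_card_nsmul _ _ _ fun w _ => Finset.card_le_card Finset.inter_subset_left
  have h3 : 9 * ∑ w ∈ agreeNbhd G u, (S ∩ posNbhd G w).card ≤
      (agreeNbhd G u).card * (10 * posDeg G u) := by
    rw [Finset.mul_sum, ← smul_eq_mul]
    refine Finset.sum_le_card_nsmul _ _ _ fun w hw => ?_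
    have : (S ∩ posNbhd G w).card ≤ posDeg G w := Finset.card_le_card Finset.inter_subset_right
    have := (mem_agreeNbhd.1 hw).2.2
    have := commonDeg_le_left (G := G) (u := u) (v := w)
    omega
  have h4 := hu.lossDeg_le
  have h5 := lossDeg_add (G := G) (u := u)
  have h6 := posDeg_pos (G := G) (u := u)
  have h7 : lossDeg G u * S.card * 10 ≤ posDeg G u * S.card := by nlinarith
  have h8 : (agreeNbhd G u).card * (10 * posDeg G u) ≤ posDeg G u * (10 * posDeg G u) := by
    gcongr; omega
  have h9 : posDeg G u * (61 * S.card) ≤ posDeg G u * (100 * posDeg G u) := by nlinarith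
  have := Nat.le_of_mul_le_mul_left h9 h6
  omega

end Agreement

/-! ### Charging to the disagreements of an arbitrary clustering -/

section Charging

variable {n : ℕ} {G : SimpleGraph (Fin n)} {C : Setoid (Fin n)} {u v : Fin n}

lemma card_le_disagreement_add {X : Finset (Fin n)}
    (h : ∀ w ∈ X, ((w ∈ posNbhd G u ∧ ¬ C.r u w) ∨ (w ∉ posNbhd G u ∧ C.r u w)) ∨
      ((w ∈ posNbhd G v ∧ ¬ C.r v w) ∨ (w ∉ posNbhd G v ∧ C.r v w))) :
    X.card ≤ disagreement G C u + disagreement G C v := by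
  refine (Finset.card_le_card fun w hw => ?_).trans (Finset.card_union_le _ _)
  simpa only [Finset.mem_union, Finset.mem_filter, Finset.mem_univ, true_and] using h w hw

/-- Separating two vertices costs their common neighbours. -/
lemma commonDeg_le_disagreement (h : ¬ C.r u v) :
    commonDeg G u v ≤ disagreement G C u + disagreement G C v := by
  refine card_le_disagreement_add fun w hw => ?_
  rw [Finset.mem_inter] at hw
  have : C.r u w → ¬ C.r v w := fun h1 h2 => h (C.trans h1 (C.symm h2))
  tauto

/-- Joining two vertices costs the difference of their neighbourhoods. -/
lemma card_sdiff_le_disagreement (h : C.r u v) :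
    (posNbhd G u \ posNbhd G v).card ≤ disagreement G C u + disagreement G C v := by
  refine card_le_disagreement_add fun w hw => ?_
  rw [Finset.mem_sdiff] at hw
  have : C.r u w → C.r v w := fun h1 => C.trans (C.symm h) h1
  tauto

/-- Without agreement the larger neighbourhood has more than a tenth of its members outside the
other one, and that difference is paid for when u and v are joined. -/
lemma max_posDeg_le_of_not_agree (h : C.r u v) (hA : ¬ Agree G u v) :
    max (posDeg G u) (posDeg G v) ≤ 10 * (disagreement G C u + disagreement G C v) := by
  have h1 := card_sdiff_le_disagreement (G := G) h
  have h2 := card_sdiff_le_disagreement (G := G) (C.symm h)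
  have h3 := Finset.card_sdiff_add_card_inter (posNbhd G u) (posNbhd G v)
  have h4 := Finset.card_sdiff_add_card_inter (posNbhd G v) (posNbhd G u)
  rw [Finset.inter_comm] at h4
  change _ + commonDeg G u v = posDeg G u at h3
  change _ + commonDeg G u v = posDeg G v at h4
  rw [Agree] at hA
  omega

lemma max_posDeg_le_of_linked (h : ¬ C.r u v) (hA : Linked G u v) :
    max (posDeg G u) (posDeg G v) ≤ 2 * (disagreement G C u + disagreement G C v) := by
  have h1 := commonDeg_le_disagreement (G := G) h
  have := hA.le_commonDeg
  omega

variable (G) in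
/-- A weighted average over a neighbourhood system. -/
noncomputable def nbhdAvg (S : Fin n → Finset (Fin n)) (f : Fin n → ℝ) (u : Fin n) : ℝ :=
  ∑ v ∈ S u, f v / (max (posDeg G u) (posDeg G v) : ℕ)

lemma nbhdAvg_nonneg (S : Fin n → Finset (Fin n)) {f : Fin n → ℝ} (hf : ∀ u, 0 ≤ f u)
    (u : Fin n) : 0 ≤ nbhdAvg G S f u :=
  Finset.sum_nonneg fun v _ => div_nonneg (hf v) (Nat.cast_nonneg _)

lemma max_posDeg_pos : (0 : ℝ) < (max (posDeg G u) (posDeg G v) : ℕ) :=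
  Nat.cast_pos.2 (posDeg_pos.trans_le (le_max_left _ _))

lemma sum_inv_max_le {S : Finset (Fin n)} {a : ℝ} (hS : (S.card : ℝ) ≤ a * posDeg G u) :
    ∑ v ∈ S, (1 : ℝ) / (max (posDeg G u) (posDeg G v) : ℕ) ≤ a := by
  have hd : (0 : ℝ) < posDeg G u := Nat.cast_pos.2 posDeg_pos
  calc ∑ v ∈ S, (1 : ℝ) / (max (posDeg G u) (posDeg G v) : ℕ) ≤ S.card • (1 / posDeg G u : ℝ) := by
        refine Finset.sum_le_card_nsmul _ _ _ fun v _ => ?_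
        exact one_div_le_one_div_of_le hd (Nat.cast_le.2 (le_max_left _ _))
    _ ≤ a := by
        rw [nsmul_eq_mul, mul_one_div, div_le_iff₀ hd]; exact hS

/-- Dividing by the maximum of the two degrees makes the kernel symmetric, so the row bound obtained
from the size of `S u` is a column bound too. -/
lemma lpNorm_nbhdAvg_le {p : ENNReal} (hp : 1 ≤ p) {S : Fin n → Finset (Fin n)} {a : ℝ}
    (ha : 0 ≤ a) (hS : ∀ u v, v ∈ S u ↔ u ∈ S v)
    (hcard : ∀ u, ((S u).card : ℝ) ≤ a * posDeg G u)
    {f : Fin n → ℝ} (hf : ∀ u, 0 ≤ f u) : lpNorm p (nbhdAvg G S f) ≤ a * lpNorm p f := by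
  have hrow : ∀ u, ∑ v, (if v ∈ S u then (1 : ℝ) / (max (posDeg G u) (posDeg G v) : ℕ) else 0)
      ≤ a := fun u => by
    rw [Finset.sum_ite_mem, Finset.univ_inter]
    exact sum_inv_max_le (hcard u)
  have := lpNorm_sum_mul_le hp
    (M := fun u v => if v ∈ S u then (1 : ℝ) / (max (posDeg G u) (posDeg G v) : ℕ) else 0) ha
    (fun u v => by positivity) hrow
    (fun v => by
      simp_rw [hS _ v, max_comm (posDeg G _) (posDeg G v)]
      exact hrow v) hf
  refine le_of_eq_of_le ?_ this
  congr 1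
  ext u
  simp_rw [ite_mul, zero_mul]
  rw [Finset.sum_ite_mem, Finset.univ_inter, nbhdAvg]
  exact Finset.sum_congr rfl fun v _ => by ring

/-- The charging scheme: by `h` each element of T can be replaced by a charge of at least 1. The
shares of u sum to at most a · f(u), and the shares of the v form the average. -/
lemma card_le_nbhdAvg {S : Fin n → Finset (Fin n)} {a c : ℝ} (hc : 0 ≤ c)
    {f : Fin n → ℝ} (hf : ∀ u, 0 ≤ f u) {T : Finset (Fin n)} (hT : T ⊆ S u)
    (hcard : ((S u).card : ℝ) ≤ a * posDeg G u)
    (h : ∀ v ∈ T, ((max (posDeg G u) (posDeg G v) : ℕ) : ℝ) ≤ c * (f u + f v)) :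
    (T.card : ℝ) ≤ c * (a * f u + nbhdAvg G S f u) := by
  calc (T.card : ℝ) = ∑ v ∈ T, (1 : ℝ) := by simp
    _ ≤ ∑ v ∈ T, c * (f u + f v) / (max (posDeg G u) (posDeg G v) : ℕ) := by
        refine Finset.sum_le_sum fun v hv => ?_
        rw [one_le_div max_posDeg_pos]
        exact h v hv
    _ ≤ ∑ v ∈ S u, c * (f u + f v) / (max (posDeg G u) (posDeg G v) : ℕ) := by
        refine Finset.sum_le_sum_of_subset_of_nonneg hT fun v _ _ => ?_
        have := hf u
        have := hf v
        positivity
    _ = c * ((∑ v ∈ S u, (1 : ℝ) / (max (posDeg G u) (posDeg G v) : ℕ)) * f u +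
          nbhdAvg G S f u) := by
        rw [nbhdAvg, Finset.sum_mul, ← Finset.sum_add_distrib, Finset.mul_sum]
        exact Finset.sum_congr rfl fun v _ => by ring
    _ ≤ _ := by
        have := sum_inv_max_le hcard
        have := hf u
        gcongr

/-- A lost neighbour is either cut off from u by C, which is a disagreement at u, or joined to u
without agreeing and charged with constant 10. -/
lemma lossDeg_le (C : Setoid (Fin n)) (u : Fin n) :
    (lossDeg G u : ℝ) ≤ 11 * disagreement G C u +
      10 * nbhdAvg G (posNbhd G) (fun v => (disagreement G C v : ℝ)) u := by
  classical
  have h1 : lossDeg G u ≤ disagreement G C u +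
      ((posNbhd G u).filter fun v => C.r u v ∧ ¬ Agree G u v).card := by
    refine (Finset.card_le_card fun v hv => ?_).trans (Finset.card_union_le _ _)
    rw [Finset.mem_sdiff, mem_agreeNbhd] at hv
    simp only [Finset.mem_union, Finset.mem_filter, Finset.mem_univ, true_and]
    tauto
  have h2 := card_le_nbhdAvg (G := G) (S := posNbhd G) (u := u) (a := 1) (c := 10)
    (f := fun v => (disagreement G C v : ℝ)) (by norm_num) (fun _ => Nat.cast_nonneg _)
    (Finset.filter_subset (fun v => C.r u v ∧ ¬ Agree G u v) _) (by rw [one_mul]; rfl)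
    (fun v hv => by
      rw [Finset.mem_filter] at hv
      exact_mod_cast max_posDeg_le_of_not_agree hv.2.1 hv.2.2)
  have h3 : (lossDeg G u : ℝ) ≤ disagreement G C u +
      ((posNbhd G u).filter fun v => C.r u v ∧ ¬ Agree G u v).card := by exact_mod_cast h1
  linarith

/-- A vertex that is not heavy loses a tenth of its neighbours, which pays for all of them. If u is
heavy, a cut neighbour v that agrees with u cannot be heavy, since v itself would witness the link.
Then d(v) ≤ 10 · loss(v) and d(u) ≤ 10/9 d(v), whence the constant 12 ≥ 100/9. -/
lemma card_cut_le {C : Setoid (Fin n)} (hC : ∀ u v, Linked G u v → C.r u v) (u : Fin n)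
    {X : Finset (Fin n)} (hX : ∀ v ∈ X, v ∈ posNbhd G u ∧ ¬ C.r u v) :
    (X.card : ℝ) ≤ 13 * lossDeg G u +
      12 * nbhdAvg G (posNbhd G) (fun v => (lossDeg G v : ℝ)) u := by
  classical
  have hnn := nbhdAvg_nonneg (G := G) (posNbhd G) (f := fun v => (lossDeg G v : ℝ))
    (fun _ => Nat.cast_nonneg _) u
  by_cases hu : Heavy G u
  swap
  · have h1 : X.card ≤ posDeg G u := Finset.card_le_card fun v hv => (hX v hv).1
    have h2 : (X.card : ℝ) ≤ 10 * lossDeg G u := by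
      exact_mod_cast h1.trans (posDeg_le_of_not_heavy hu)
    have : (0 : ℝ) ≤ lossDeg G u := Nat.cast_nonneg _
    linarith
  have h1 : X.card ≤ lossDeg G u + ((agreeNbhd G u).filter fun v => ¬ Heavy G v).card := by
    refine (Finset.card_le_card fun v hv => ?_).trans (Finset.card_union_le _ _)
    obtain ⟨h3, h4⟩ := hX v hv
    simp only [Finset.mem_union, Finset.mem_filter, Finset.mem_sdiff]
    have : v ∈ agreeNbhd G u → ¬ Heavy G v := fun h5 h6 =>
      h4 (hC u v ⟨hu, h6, v, h5, self_mem_agreeNbhd⟩)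
    tauto
  have h2 := card_le_nbhdAvg (G := G) (S := posNbhd G) (u := u) (a := 1) (c := 12)
    (f := fun v => (lossDeg G v : ℝ)) (by norm_num) (fun _ => Nat.cast_nonneg _)
    ((Finset.filter_subset (fun v => ¬ Heavy G v) _).trans agreeNbhd_subset)
    (by rw [one_mul]; rfl)
    (fun v hv => by
      rw [Finset.mem_filter] at hv
      have h3 := posDeg_le_of_not_heavy hv.2
      have h4 := (mem_agreeNbhd.1 hv.1).2.1
      have h5 := commonDeg_le_right (G := G) (u := u) (v := v)
      have : max (posDeg G u) (posDeg G v) ≤ 12 * (lossDeg G u + lossDeg G v) := by omega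
      exact_mod_cast this)
  have h3 : (X.card : ℝ) ≤ lossDeg G u + ((agreeNbhd G u).filter fun v => ¬ Heavy G v).card := by
    exact_mod_cast h1
  linarith

/-- A negative pair that is linked is either joined by C too, a disagreement at u, or separated by
C, where the large common neighbourhood pays. -/
lemma card_joined_le (C : Setoid (Fin n)) (u : Fin n)
    {X : Finset (Fin n)} (hX : ∀ v ∈ X, v ∉ posNbhd G u ∧ Linked G u v) :
    (X.card : ℝ) ≤ 5 * disagreement G C u +
      2 * nbhdAvg G (linkedSet G) (fun v => (disagreement G C v : ℝ)) u := by
  classical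
  have h1 : X.card ≤ disagreement G C u +
      ((linkedSet G u).filter fun v => ¬ C.r u v).card := by
    refine (Finset.card_le_card fun v hv => ?_).trans (Finset.card_union_le _ _)
    have := hX v hv
    simp only [Finset.mem_union, Finset.mem_filter, Finset.mem_univ, true_and, mem_linkedSet]
    tauto
  have h2 := card_le_nbhdAvg (G := G) (S := linkedSet G) (u := u) (a := 2) (c := 2)
    (f := fun v => (disagreement G C v : ℝ)) (by norm_num) (fun _ => Nat.cast_nonneg _)
    (Finset.filter_subset (fun v => ¬ C.r u v) _) (by exact_mod_cast card_linkedSet_le)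
    (fun v hv => by
      rw [Finset.mem_filter, mem_linkedSet] at hv
      exact_mod_cast max_posDeg_le_of_linked hv.2 hv.1)
  have h3 : (X.card : ℝ) ≤ disagreement G C u +
      ((linkedSet G u).filter fun v => ¬ C.r u v).card := by exact_mod_cast h1
  linarith

/-- The clustering into classes of linked vertices and singletons approximates all norms. -/
theorem lpCost_le_of_linked {C : Setoid (Fin n)} (hC : ∀ u v, C.r u v ↔ u = v ∨ Linked G u v)
    {p : ENNReal} (hp : 1 ≤ p) (C' : Setoid (Fin n)) :
    lpCost G p C ≤ 807 * lpCost G p C' := by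
  classical
  set y : Fin n → ℝ := fun u => (disagreement G C' u : ℝ)
  set l : Fin n → ℝ := fun u => (lossDeg G u : ℝ)
  have hy : ∀ u, 0 ≤ y u := fun _ => Nat.cast_nonneg _
  have hl : ∀ u, 0 ≤ l u := fun _ => Nat.cast_nonneg _
  have hN : ∀ f : Fin n → ℝ, (∀ u, 0 ≤ f u) →
      lpNorm p (nbhdAvg G (posNbhd G) f) ≤ lpNorm p f := fun f hf => by
    have := lpNorm_nbhdAvg_le (G := G) (S := posNbhd G) (a := 1) hp (by norm_num)
      (fun _ _ => mem_posNbhd_comm) (fun u => by rw [one_mul]; rfl) hf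
    rwa [one_mul] at this
  have hL := lpNorm_nbhdAvg_le (G := G) (S := linkedSet G) (a := 2) hp (by norm_num)
    (fun u v => by rw [mem_linkedSet, mem_linkedSet]; exact ⟨Linked.symm, Linked.symm⟩)
    (fun u => by exact_mod_cast card_linkedSet_le) hy
  have h1 : lpNorm p l ≤ 21 * lpNorm p y := by
    calc lpNorm p l ≤ lpNorm p ((11 : ℝ) • y + (10 : ℝ) • nbhdAvg G (posNbhd G) y) :=
          lpNorm_mono hp hl fun u => lossDeg_le C' u
      _ ≤ 11 * lpNorm p y + 10 * lpNorm p (nbhdAvg G (posNbhd G) y) := by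
          refine (lpNorm_add_le hp _ _).trans_eq ?_
          rw [lpNorm_smul hp (by norm_num), lpNorm_smul hp (by norm_num)]
      _ ≤ _ := by linarith [hN y hy]
  have h2 : ∀ u, (disagreement G C u : ℝ) ≤
      ((13 : ℝ) • l + (12 : ℝ) • nbhdAvg G (posNbhd G) l +
        ((5 : ℝ) • y + (2 : ℝ) • nbhdAvg G (linkedSet G) y)) u := fun u => by
    have h3 : disagreement G C u ≤
        (Finset.univ.filter fun v => v ∈ posNbhd G u ∧ ¬ C.r u v).card +
          (Finset.univ.filter fun v => v ∉ posNbhd G u ∧ C.r u v).card := by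
      rw [disagreement, Finset.filter_or]
      exact Finset.card_union_le _ _
    have h4 := card_cut_le (G := G) (fun u v h => (hC u v).2 (.inr h)) u
      (X := Finset.univ.filter fun v => v ∈ posNbhd G u ∧ ¬ C.r u v)
      fun v hv => (Finset.mem_filter.1 hv).2
    have h5 := card_joined_le (G := G) C' u
      (X := Finset.univ.filter fun v => v ∉ posNbhd G u ∧ C.r u v) fun v hv => by
        have h6 := (Finset.mem_filter.1 hv).2
        refine ⟨h6.1, ((hC u v).1 h6.2).resolve_left ?_⟩
        rintro rfl
        exact h6.1 self_mem_posNbhd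
    have h7 : (disagreement G C u : ℝ) ≤
        (Finset.univ.filter fun v => v ∈ posNbhd G u ∧ ¬ C.r u v).card +
          (Finset.univ.filter fun v => v ∉ posNbhd G u ∧ C.r u v).card := by exact_mod_cast h3
    simp only [Pi.add_apply, Pi.smul_apply, smul_eq_mul]
    exact h7.trans (add_le_add h4 h5)
  change lpNorm p (fun u => (disagreement G C u : ℝ)) ≤ 807 * lpNorm p y
  have h3 := lpNorm_mono hp (fun u => Nat.cast_nonneg _) h2
  have h4 := lpNorm_add_le hp ((13 : ℝ) • l + (12 : ℝ) • nbhdAvg G (posNbhd G) l)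
    ((5 : ℝ) • y + (2 : ℝ) • nbhdAvg G (linkedSet G) y)
  have h5 := lpNorm_add_le hp ((13 : ℝ) • l) ((12 : ℝ) • nbhdAvg G (posNbhd G) l)
  have h6 := lpNorm_add_le hp ((5 : ℝ) • y) ((2 : ℝ) • nbhdAvg G (linkedSet G) y)
  rw [lpNorm_smul hp (by norm_num), lpNorm_smul hp (by norm_num)] at h5 h6
  have h7 := hN l hl
  -- The estimates add up to (13 + 12) · 21 + 5 + 2 · 2 = 534. Nonnegativity of the norm allows the
  -- larger constant 807.
  have h8 : 0 ≤ lpNorm p y := by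
    have := lpNorm_mono hp (f := fun _ : Fin n => (0 : ℝ)) (fun _ => le_rfl) hy
    have h9 := lpNorm_smul hp le_rfl y
    rw [zero_smul, zero_mul] at h9
    exact h9.symm.le.trans this
  linarith

end Charging

end CorrClust

/-! ### Reasoning about programs: symbolic evaluation, frames and loops -/

namespace WordRAM

namespace State

variable (s : State) (x a i v : ℕ)

@[simp] lemma reg_setReg (y : ℕ) : (s.setReg x v).reg y = if y = x then v else s.reg y := by
  simp [setReg, Function.update_apply]

@[simp] lemma arr_setReg : (s.setReg x v).arr = s.arr := rfl

@[simp] lemma reg_setArr : (s.setArr a i v).reg = s.reg := rfl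

@[simp] lemma arr_setArr (b j : ℕ) :
    (s.setArr a i v).arr b j = if b = a ∧ j = i then v else s.arr b j := by
  by_cases hb : b = a
  · subst hb; simp [setArr, Function.update_apply]
  · simp [setArr, hb]

lemma arr_setArr_of_ne {b : ℕ} (hb : b ≠ a) : (s.setArr a i v).arr b = s.arr b := by
  simp [setArr, hb]

end State

open Classical in
/-- The final state of a program without loops. -/
noncomputable def Program.eval : Program → State → State
  | .skip, s => s
  | .const x c, s => s.setReg x c
  | .copy x y, s => s.setReg x (s.reg y)
  | .arith o x y z, s => s.setReg x (o.eval (s.reg y) (s.reg z))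
  | .load x a i, s => s.setReg x (s.arr a (s.reg i))
  | .store a i x, s => s.setArr a (s.reg i) (s.reg x)
  | .seq p q, s => q.eval (p.eval s)
  | .cond b p q, s => if b.holds s then p.eval s else q.eval s
  | .loop _ _, s => s

/-- No instruction of a program without loops overflows. -/
def Program.Safe (W : ℕ) : Program → State → Prop
  | .skip, _ => True
  | .const _ c, _ => c < W
  | .copy _ y, s => s.reg y < W
  | .arith o _ y z, s => o.eval (s.reg y) (s.reg z) < W
  | .load _ a i, s => s.reg i < W ∧ s.arr a (s.reg i) < W
  | .store _ i x, s => s.reg i < W ∧ s.reg x < W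
  | .seq p q, s => p.Safe W s ∧ q.Safe W (p.eval s)
  | .cond b p q, s => (b.holds s → p.Safe W s) ∧ (¬ b.holds s → q.Safe W s)
  | .loop _ _, _ => False

/-- A bound for the running time of a program without loops. -/
def Program.cost : Program → ℕ
  | .seq p q => p.cost + q.cost
  | .cond _ p q => 1 + max p.cost q.cost
  | _ => 1

/-- The registers a program may write to. -/
def Program.modRegs : Program → List ℕ
  | .const x _ | .copy x _ | .arith _ x _ _ | .load x _ _ => [x]
  | .seq p q | .cond _ p q => p.modRegs ++ q.modRegs
  | .loop _ p => p.modRegs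
  | _ => []

/-- The arrays a program may write to. -/
def Program.modArrs : Program → List ℕ
  | .store a _ _ => [a]
  | .seq p q | .cond _ p q => p.modArrs ++ q.modArrs
  | .loop _ p => p.modArrs
  | _ => []

/-- Two states agree on everything a program does not write to. -/
structure Frame (p : Program) (s s' : State) : Prop where
  reg : ∀ x, x ∉ p.modRegs → s'.reg x = s.reg x
  arr : ∀ a, a ∉ p.modArrs → s'.arr a = s.arr a

lemma Frame.refl (p : Program) (s : State) : Frame p s s := ⟨fun _ _ => rfl, fun _ _ => rfl⟩

lemma Frame.trans {p : Program} {s s' s'' : State} (h : Frame p s s') (h' : Frame p s' s'') :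
    Frame p s s'' :=
  ⟨fun x hx => (h'.reg x hx).trans (h.reg x hx), fun a ha => (h'.arr a ha).trans (h.arr a ha)⟩

lemma Frame.mono {p q : Program} {s s' : State} (h : Frame p s s')
    (hr : p.modRegs ⊆ q.modRegs) (ha : p.modArrs ⊆ q.modArrs) : Frame q s s' :=
  ⟨fun x hx => h.reg x fun h' => hx (hr h'), fun a hx => h.arr a fun h' => hx (ha h')⟩

/-- The lists of written registers and arrays depend only on the program text, so preservation
claims become decidable membership checks. -/
lemma Exec.frame {W : ℕ} {p : Program} {s s' : State} {T : ℕ} (h : Exec W p s T s') :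
    Frame p s s' := by
  induction h with
  | skip s => exact .refl _ _
  | const s x c h | copy s x y h | arith s o x y z h | load s x a i hi h =>
    refine ⟨fun y hy => ?_, fun a _ => rfl⟩
    rw [State.reg_setReg, if_neg]
    rintro rfl
    simp [Program.modRegs] at hy
  | store s a i x hi h =>
    refine ⟨fun y hy => rfl, fun b hb => ?_⟩
    refine s.arr_setArr_of_ne _ _ _ ?_
    rintro rfl
    simp [Program.modArrs] at hb
  | seq _ _ ih ih' =>
    exact (ih.mono (List.subset_append_left _ _) (List.subset_append_left _ _)).trans
      (ih'.mono (List.subset_append_right _ _) (List.subset_append_right _ _))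
  | cond_true _ _ ih => exact ih.mono (List.subset_append_left _ _) (List.subset_append_left _ _)
  | cond_false _ _ ih => exact ih.mono (List.subset_append_right _ _) (List.subset_append_right _ _)
  | loop_false _ => exact .refl _ _
  | loop_true _ _ _ ih ih' =>
    exact (ih.mono (q := .loop _ _) (fun _ h => h) (fun _ h => h)).trans ih'

/-- The program halts within `B` steps in a state with property `Q`. -/
def Runs (W : ℕ) (p : Program) (s : State) (B : ℕ) (Q : State → Prop) : Prop :=
  ∃ T s', Exec W p s T s' ∧ T ≤ B ∧ Q s'

variable {W B B' : ℕ} {p q : Program} {s : State} {Q R : State → Prop}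

/-- Reduces loop-free code to computing `Program.eval` and checking overflows, so that only loops
need invariants. -/
lemma Program.Safe.exec (h : p.Safe W s) : ∃ T ≤ p.cost, Exec W p s T (p.eval s) := by
  induction p generalizing s with
  | skip => exact ⟨1, le_rfl, .skip s⟩
  | const x c => exact ⟨1, le_rfl, .const s x c h⟩
  | copy x y => exact ⟨1, le_rfl, .copy s x y h⟩
  | arith o x y z => exact ⟨1, le_rfl, .arith s o x y z h⟩
  | load x a i => exact ⟨1, le_rfl, .load s x a i h.1 h.2⟩
  | store a i x => exact ⟨1, le_rfl, .store s a i x h.1 h.2⟩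
  | seq p q ihp ihq =>
    obtain ⟨T, hT, hp⟩ := ihp h.1
    obtain ⟨T', hT', hq⟩ := ihq h.2
    exact ⟨T + T', add_le_add hT hT', .seq hp hq⟩
  | cond b p q ihp ihq =>
    by_cases hb : b.holds s
    · obtain ⟨T, hT, hp⟩ := ihp (h.1 hb)
      refine ⟨1 + T, ?_, ?_⟩
      · have := le_max_left p.cost q.cost
        rw [Program.cost]; omega
      · rw [Program.eval, if_pos hb]; exact .cond_true hb hp
    · obtain ⟨T, hT, hq⟩ := ihq (h.2 hb)
      refine ⟨1 + T, ?_, ?_⟩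
      · have := le_max_right p.cost q.cost
        rw [Program.cost]; omega
      · rw [Program.eval, if_neg hb]; exact .cond_false hb hq
  | loop b p => exact h.elim

lemma Runs.block (h : p.Safe W s) (hB : p.cost ≤ B) (hQ : Q (p.eval s)) : Runs W p s B Q := by
  obtain ⟨T, hT, he⟩ := h.exec
  exact ⟨T, _, he, hT.trans hB, hQ⟩

lemma Runs.mono (h : Runs W p s B Q) (hB : B ≤ B') (hQ : ∀ s', Q s' → R s') :
    Runs W p s B' R := by
  obtain ⟨T, s', h1, h2, h3⟩ := h
  exact ⟨T, s', h1, h2.trans hB, hQ _ h3⟩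

lemma Runs.frame (h : Runs W p s B Q) : Runs W p s B fun s' => Frame p s s' ∧ Q s' := by
  obtain ⟨T, s', h1, h2, h3⟩ := h
  exact ⟨T, s', h1, h2, h1.frame, h3⟩

lemma Runs.seq (h : Runs W p s B R) (h' : ∀ s', R s' → Runs W q s' B' Q) :
    Runs W (.seq p q) s (B + B') Q := by
  obtain ⟨T, s', h1, h2, h3⟩ := h
  obtain ⟨T', s'', h4, h5, h6⟩ := h' s' h3
  exact ⟨T + T', s'', .seq h1 h4, add_le_add h2 h5, h6⟩

/-- A loop with an invariant indexed by the number of rounds. -/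
lemma Runs.loop {b : Test} {N : ℕ} (I : ℕ → State → Prop) {s : State} (h0 : I 0 s)
    (hb : ∀ i ≤ N, ∀ s', Frame p s s' → I i s' → (b.holds s' ↔ i < N))
    (hstep : ∀ i < N, ∀ s', Frame p s s' → I i s' → Runs W p s' B (I (i + 1))) :
    Runs W (.loop b p) s (1 + N * (1 + B)) fun s' => Frame p s s' ∧ I N s' := by
  -- Induction on the number k of remaining rounds; the frame is always taken from the state before
  -- the loop.
  have key : ∀ k i, i + k = N → ∀ s', Frame p s s' → I i s' →
      Runs W (.loop b p) s' (1 + k * (1 + B)) fun s' => Frame p s s' ∧ I N s' := by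
    intro k
    induction k with
    | zero =>
      intro i hi s' hf hI
      obtain rfl : i = N := by omega
      have : ¬ b.holds s' := fun h => by simpa using (hb i le_rfl s' hf hI).1 h
      exact ⟨1, s', .loop_false this, by omega, hf, hI⟩
    | succ k ih =>
      intro i hi s' hf hI
      obtain ⟨T, s₁, h1, h2, h3⟩ := hstep i (by omega) s' hf hI
      obtain ⟨T', s₂, h4, h5, h6⟩ := ih (i + 1) (by omega) s₁ (hf.trans h1.frame) h3
      refine ⟨1 + T + T', s₂, .loop_true ((hb i (by omega) s' hf hI).2 (by omega)) h1 h4, ?_, h6⟩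
      rw [add_mul]; omega
  exact key N 0 (by omega) s (.refl _ _) h0

end WordRAM

namespace CorrClust

open WordRAM

/-! ### The adjacency lists in memory -/

section Input

variable {n : ℕ} {G : SimpleGraph (Fin n)} {adj : Fin n → List (Fin n)}

lemma IsAdjList.mem_posNbhd (h : IsAdjList G adj) {u v : Fin n} :
    v ∈ posNbhd G u ↔ v = u ∨ v ∈ adj u := by
  rw [CorrClust.mem_posNbhd, h.mem_iff]

lemma IsAdjList.self_notMem (h : IsAdjList G adj) (u : Fin n) : u ∉ adj u := by
  rw [h.mem_iff]; exact G.loopless.irrefl u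

/-- The 1 is the self-loop, which the lists omit. This is why the counters of the program start at
1. -/
lemma IsAdjList.one_add_countP (h : IsAdjList G adj) (u : Fin n) (P : Fin n → Prop)
    [DecidablePred P] (hu : P u) :
    1 + (adj u).countP (fun v => decide (P v)) = ((posNbhd G u).filter P).card := by
  have h1 : (posNbhd G u).filter P = insert u ((adj u).filter fun v => decide (P v)).toFinset := by
    ext v
    simp only [Finset.mem_filter, h.mem_posNbhd, Finset.mem_insert, List.mem_toFinset,
      List.mem_filter, decide_eq_true_eq]
    constructor
    · rintro ⟨rfl | h1, h2⟩
      · exact .inl rfl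
      · exact .inr ⟨h1, h2⟩
    · rintro (rfl | h1)
      · exact ⟨.inl rfl, hu⟩
      · exact ⟨.inr h1.1, h1.2⟩
  rw [h1, Finset.card_insert_of_notMem, List.toFinset_card_of_nodup ((h.nodup u).filter _),
    ← List.countP_eq_length_filter, add_comm]
  simp [h.self_notMem]

lemma IsAdjList.posDeg_eq (h : IsAdjList G adj) (u : Fin n) :
    posDeg G u = (adj u).length + 1 := by
  have := h.one_add_countP u (fun _ => True) trivial
  simp only [Finset.filter_true] at this
  rw [posDeg, ← this]
  simp [add_comm]

lemma IsAdjList.length_lt (h : IsAdjList G adj) (u : Fin n) : (adj u).length < n := by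
  have := h.posDeg_eq u
  have := posDeg_le_card (G := G) (u := u)
  omega

/-- The arrays `0` and `1` hold the adjacency lists, and the registers `0` to `3` the number of
vertices and some constants. -/
structure Env (adj : Fin n → List (Fin n)) (s : State) : Prop where
  size : s.reg 0 = n
  one : s.reg 1 = 1
  nine : s.reg 2 = 9
  ten : s.reg 3 = 10
  off_zero : s.arr 0 0 = 0
  off_succ : ∀ u : Fin n, s.arr 0 (u + 1) = s.arr 0 u + (adj u).length
  nbr : ∀ (u : Fin n) (t : ℕ) (ht : t < (adj u).length), s.arr 1 (s.arr 0 u + t) = (adj u)[t]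

lemma Env.frame {p : Program} {s s' : State} (h : Env adj s) (hf : Frame p s s')
    (hr : ∀ x < 4, x ∉ p.modRegs) (ha : ∀ a < 2, a ∉ p.modArrs) : Env adj s' := by
  obtain ⟨h1, h2, h3, h4, h5, h6, h7⟩ := h
  rw [← hf.reg _ (hr _ (by norm_num))] at h1 h2 h3 h4
  rw [← hf.arr 0 (ha 0 (by norm_num))] at h5 h6 h7
  rw [← hf.arr _ (ha 1 (by norm_num))] at h7
  exact ⟨h1, h2, h3, h4, h5, h6, h7⟩

/-- Every list is shorter than n. Offsets are the only quadratic quantities handled, so this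
explains the n² in the word bound; the linear terms cover names and multiples by 9 and 10. -/
lemma Env.off_le {s : State} (h : Env adj s) (hG : IsAdjList G adj) {i : ℕ} (hi : i ≤ n) :
    s.arr 0 i ≤ n * n := by
  have : s.arr 0 i ≤ i * n := by
    induction i with
    | zero => rw [h.off_zero]; exact Nat.zero_le _
    | succ i ih =>
      have h1 := h.off_succ ⟨i, hi⟩
      have h2 := hG.length_lt ⟨i, hi⟩
      have h3 := ih (by omega)
      simp only at h1
      rw [h1, add_mul]
      omega
  exact this.trans (Nat.mul_le_mul_right _ hi)

lemma Env.off_mono {s : State} (h : Env adj s) {i j : ℕ} (hij : i ≤ j) (hj : j ≤ n) :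
    s.arr 0 i ≤ s.arr 0 j := by
  induction j, hij using Nat.le_induction with
  | base => exact le_rfl
  | succ j _ ih =>
    have := h.off_succ ⟨j, hj⟩
    have := ih (by omega)
    simp only at *
    omega

/-- The blocks of distinct vertices do not overlap, so flags written for a later vertex spare those
of earlier ones. -/
lemma Env.off_add_length_le {s : State} (h : Env adj s) {u v : Fin n} (huv : u < v) :
    s.arr 0 u + (adj u).length ≤ s.arr 0 v := by
  rw [← h.off_succ]
  exact h.off_mono huv v.2.le

lemma flatten_take_succ {α : Type*} (L : List (List α)) (i : ℕ) (hi : i < L.length) :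
    (L.take (i + 1)).flatten = (L.take i).flatten ++ L[i] := by
  rw [List.take_succ_eq_append_getElem hi, List.flatten_append]
  simp

lemma getElem?_flatten_take {α : Type*} (L : List (List α)) (i t : ℕ) (hi : i < L.length)
    (ht : t < L[i].length) : L.flatten[(L.take i).flatten.length + t]? = some L[i][t] := by
  have h1 : L.flatten = (L.take (i + 1)).flatten ++ (L.drop (i + 1)).flatten := by
    rw [← List.flatten_append, List.take_append_drop]
  rw [h1, flatten_take_succ L i hi, List.append_assoc, List.getElem?_append_right (by omega),
    Nat.add_sub_cancel_left, List.getElem?_append_left ht, List.getElem?_eq_getElem ht]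

lemma env_inputState {s : State} (h0 : s.arr 0 = (inputState adj).arr 0)
    (h1 : s.arr 1 = (inputState adj).arr 1) (hn : s.reg 0 = n) (h2 : s.reg 1 = 1)
    (h3 : s.reg 2 = 9) (h4 : s.reg 3 = 10) : Env adj s := by
  have hoff : ∀ i ≤ n, s.arr 0 i = ((List.ofFn adj).take i).flatten.length := fun i hi => by
    rw [h0]; simp [inputState, hi]
  refine ⟨hn, h2, h3, h4, ?_, fun u => ?_, fun u t ht => ?_⟩
  · rw [hoff 0 (Nat.zero_le _)]; simp
  · rw [hoff _ u.2, hoff _ u.2.le, flatten_take_succ _ _ (by simp)]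
    simp
  · rw [hoff _ u.2.le, h1]
    have := getElem?_flatten_take (List.ofFn adj) u t (by simp) (by simpa using ht)
    simp only [inputState]
    simp only [one_ne_zero, if_false, if_true]
    rw [List.getD_eq_getElem?_getD, List.getElem?_map, this]
    simp

end Input

/-! ### The clustering program and its correctness -/

section Machine

variable {n W : ℕ} {G : SimpleGraph (Fin n)} {adj : Fin n → List (Fin n)}

/-- Stamp the current neighbour in array `3`. -/
def markBody : Program :=
  -- Throughout, register 4 is the current vertex u, registers 5 and 6 are the cursor and end of its
  -- list, 7 is u + 1 and 8 is the current neighbour. Array 3 holds stamps, array 4 holds agreement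
  -- flags parallel to array 1, array 5 holds names, and arrays 6 and 7 hold minima.
  .seq (.load 8 1 5) (.seq (.store 3 8 7) (.arith .add 5 5 1))

/-- The stamp of u is u + 1, larger than the initial zeros and all earlier stamps. Old stamps need
no clearing, which would cost n steps per vertex. -/
lemma runs_mark (hW : n * n + 20 * n + 60 ≤ W) (hG : IsAdjList G adj) {u : Fin n} {s : State}
    (he : Env adj s) (h5 : s.reg 5 = s.arr 0 u)
    (h6 : s.reg 6 = s.arr 0 (u + 1)) (h7 : s.reg 7 = u + 1)
    (hm : ∀ w : Fin n, (s.arr 3 w = u + 1 ↔ w = u) ∧ s.arr 3 w ≤ u + 1) :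
    Runs W (.loop (.lt 5 6) markBody) s (1 + (adj u).length * (1 + 3)) fun s' =>
      Frame markBody s s' ∧
        ∀ w : Fin n, (s'.arr 3 w = u + 1 ↔ w ∈ posNbhd G u) ∧ s'.arr 3 w ≤ u + 1 := by
  refine (Runs.loop (p := markBody) (b := .lt 5 6) (N := (adj u).length) (B := 3)
    (fun t s' => s'.reg 5 = s.arr 0 u + t ∧ ∀ w : Fin n,
      (s'.arr 3 w = u + 1 ↔ w = u ∨ w ∈ (adj u).take t) ∧ s'.arr 3 w ≤ u + 1)
    ⟨by simpa using h5, by simpa using hm⟩ ?_ ?_).mono le_rfl ?_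
  · rintro t ht s' hf ⟨h1, -⟩
    have h2 := hf.reg 6 (by decide)
    have h3 := he.off_succ u
    simp only [Test.holds]
    omega
  · rintro t ht s' hf ⟨h1, h2⟩
    have he' := he.frame hf (by decide) (by decide)
    have ho := he.off_le hG (i := u + 1) u.2
    have h3 := he.off_succ u
    have h8 := he.nbr u t ht
    have h9 := hf.reg 7 (by decide)
    have ha := hf.arr 1 (by decide)
    have hu := u.2
    have hv := ((adj u)[t]).2
    refine Runs.block ?_ (by decide) ?_
    · simp [markBody, Program.Safe, Program.eval, h1, ha, h8, h9, h7, Op.eval, he'.one]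
      omega
    · simp only [markBody, Program.eval, State.reg_setReg, State.arr_setReg, State.reg_setArr,
        State.arr_setArr, Op.eval, he'.one, h1, ha, h8, h9, h7, List.take_succ_eq_append_getElem ht,
        List.mem_append, List.mem_singleton]
      refine ⟨by simp [add_assoc], fun w => ?_⟩
      have := h2 w
      by_cases hw : w = (adj u)[t]
      · simp [hw]
      · have hw' : (w : ℕ) ≠ (adj u)[t] := fun h => hw (Fin.ext h)
        simp [hw, hw', this]
  · rintro s' ⟨hf, -, h2⟩
    refine ⟨hf, fun w => ?_⟩
    rw [hG.mem_posNbhd]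
    simpa using h2 w

/-- Count the current neighbour if it is stamped. -/
def countBody : Program :=
  .seq (.load 15 1 13) (.seq (.load 16 3 15)
    (.seq (.cond (.eq 16 7) (.arith .add 12 12 1) .skip) (.arith .add 13 13 1)))

/-- The counter starts at 1 for v itself, a common neighbour because v is adjacent to u and carries
a self-loop. -/
lemma runs_count (hW : n * n + 20 * n + 60 ≤ W) (hG : IsAdjList G adj) {u v : Fin n} {s : State}
    (he : Env adj s) (hv : v ∈ posNbhd G u) (h13 : s.reg 13 = s.arr 0 v)
    (h14 : s.reg 14 = s.arr 0 (v + 1)) (h7 : s.reg 7 = u + 1) (h12 : s.reg 12 = 1)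
    (hm : ∀ w : Fin n, (s.arr 3 w = u + 1 ↔ w ∈ posNbhd G u) ∧ s.arr 3 w ≤ u + 1) :
    Runs W (.loop (.lt 13 14) countBody) s (1 + (adj v).length * (1 + 5)) fun s' =>
      Frame countBody s s' ∧ s'.reg 12 = commonDeg G u v := by
  refine (Runs.loop (p := countBody) (b := .lt 13 14) (N := (adj v).length) (B := 5)
    (fun t s' => s'.reg 13 = s.arr 0 v + t ∧
      s'.reg 12 = 1 + ((adj v).take t).countP (fun w => decide (w ∈ posNbhd G u)))
    ⟨by simpa using h13, by simpa using h12⟩ ?_ ?_).mono le_rfl ?_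
  · rintro t ht s' hf ⟨h1, -⟩
    have h2 := hf.reg 14 (by decide)
    have h3 := he.off_succ v
    simp only [Test.holds]
    omega
  · rintro t ht s' hf ⟨h1, h2⟩
    have he' := he.frame hf (by decide) (by decide)
    have ho := he.off_le hG (i := v + 1) v.2
    have h3 := he.off_succ v
    have h8 := he.nbr v t ht
    have h9 := hf.reg 7 (by decide)
    have ha := hf.arr 1 (by decide)
    have hb := hf.arr 3 (by decide)
    have hu := u.2
    have hw := ((adj v)[t]).2
    have hm' := hm (adj v)[t]
    have hc := List.countP_le_length (l := (adj v).take t)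
      (p := fun w => decide (w ∈ posNbhd G u))
    have hl : ((adj v).take t).length ≤ t := by simp
    have hl' := hG.length_lt v
    rw [List.take_succ_eq_append_getElem ht, List.countP_append, List.countP_singleton]
    have hme := hm'.1
    refine Runs.block ?_ (by decide) ?_
    · simp [countBody, Program.Safe, Program.eval, h1, ha, hb, h8, h9, h7, h2, Op.eval, he'.one,
        Test.holds]
      split_ifs <;> simp [h1, he'.one] <;> omega
    · simp only [countBody, Program.eval, Test.holds, Op.eval]
      by_cases hq : (adj v)[t] ∈ posNbhd G u
      · have := hme.2 hq
        simp [h1, ha, hb, h8, h9, h7, h2, he'.one, hq, this]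
        omega
      · have : ¬ s.arr 3 (adj v)[t] = u + 1 := fun h => hq (hme.1 h)
        simp [h1, ha, hb, h8, h9, h7, h2, he'.one, hq, this]
        omega
  · rintro s' ⟨hf, -, h2⟩
    refine ⟨hf, ?_⟩
    rw [h2, List.take_length, hG.one_add_countP v _ hv,
      Finset.filter_mem_eq_inter, Finset.inter_comm, commonDeg]

/-- Prepare the comparison of the current vertex with the current neighbour. -/
def edgePre : Program :=
  .seq (.load 8 1 5) (.seq (.load 13 0 8) (.seq (.arith .add 14 8 1) (.seq (.load 14 0 14)
    (.seq (.arith .sub 11 14 13) (.seq (.arith .add 11 11 1) (.const 12 1))))))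

/-- Store in array `4` whether the current vertex and the current neighbour agree. -/
def edgePost : Program :=
  .seq (.arith .mul 18 3 12) (.seq (.arith .mul 16 2 9) (.seq (.arith .mul 17 2 11)
    (.seq (.const 15 0) (.seq (.cond (.le 16 18) (.cond (.le 17 18) (.const 15 1) .skip) .skip)
      (.seq (.store 4 5 15) (.seq (.arith .add 10 10 15) (.arith .add 5 5 1)))))))

/-- Process the current neighbour of the current vertex. -/
def edgeBody : Program := .seq edgePre (.seq (.loop (.lt 13 14) countBody) edgePost)

open Classical in
variable (G) in
/-- The agreement flag of a pair of vertices. -/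
noncomputable def agreeFlag (u v : Fin n) : ℕ := if Agree G u v then 1 else 0

lemma runs_edge (hW : n * n + 20 * n + 60 ≤ W) (hG : IsAdjList G adj) {u : Fin n} {t : ℕ}
    (ht : t < (adj u).length) {s : State} (he : Env adj s) (h5 : s.reg 5 = s.arr 0 u + t)
    (h7 : s.reg 7 = u + 1) (h9 : s.reg 9 = posDeg G u) (h10 : s.reg 10 ≤ n)
    (hm : ∀ w : Fin n, (s.arr 3 w = u + 1 ↔ w ∈ posNbhd G u) ∧ s.arr 3 w ≤ u + 1) :
    Runs W edgeBody s (24 * maxPosDegree G) fun s' =>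
      s'.reg 5 = s.arr 0 u + (t + 1) ∧ s'.reg 10 = s.reg 10 + agreeFlag G u (adj u)[t] ∧
      ∀ x, s'.arr 4 x = if x = s.arr 0 u + t then agreeFlag G u (adj u)[t] else s.arr 4 x := by
  set v := (adj u)[t]
  have hv : v ∈ posNbhd G u := hG.mem_posNbhd.2 (.inr (List.getElem_mem ht))
  have ho := he.off_le hG (i := u + 1) u.2
  have ho' := he.off_le hG (i := v + 1) v.2
  have hs := he.off_succ u
  have hs' := he.off_succ v
  have hd := hG.posDeg_eq v
  have hl := hG.length_lt v
  have hnb : s.arr 1 (s.arr 0 u + t) = v := he.nbr u t ht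
  have hvn := v.2
  have hD := posDeg_le_maxPosDegree (G := G) (u := v)
  refine (Runs.seq (B := 7) (R := fun s' => Frame edgePre s s' ∧ s'.reg 13 = s.arr 0 v ∧
    s'.reg 14 = s.arr 0 (v + 1) ∧ s'.reg 11 = posDeg G v ∧ s'.reg 12 = 1) ?_ (B' := _) ?_).mono
    (B := 7 + (1 + (adj v).length * (1 + 5) + 10)) (by omega) fun _ h => h
  · refine (Runs.block (B := 7) (Q := fun s' => s'.reg 13 = s.arr 0 v ∧
      s'.reg 14 = s.arr 0 (v + 1) ∧ s'.reg 11 = posDeg G v ∧ s'.reg 12 = 1) ?_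
      (by decide) ?_).frame
    · simp [edgePre, Program.Safe, Program.eval, h5, hnb, Op.eval, he.one]
      omega
    · simp [edgePre, Program.eval, h5, hnb, Op.eval, he.one]
      omega
  rintro s₁ ⟨hf, h13, h14, h11, h12⟩
  have he₁ := he.frame hf (by decide) (by decide)
  have h0₁ := hf.arr 0 (by decide)
  have h3₁ := hf.arr 3 (by decide)
  have h7₁ := hf.reg 7 (by decide)
  refine Runs.seq (runs_count hW hG (u := u) (v := v) he₁ hv (by rw [h13, h0₁])
    (by rw [h14, h0₁]) (by rw [h7₁, h7]) h12 (by rw [h3₁]; exact hm)) ?_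
  rintro s₂ ⟨hf₂, hc⟩
  have he₂ := he₁.frame hf₂ (by decide) (by decide)
  have h4 : s₂.arr 4 = s.arr 4 := (hf₂.arr 4 (by decide)).trans (hf.arr 4 (by decide))
  have h5₂ : s₂.reg 5 = s.reg 5 := (hf₂.reg 5 (by decide)).trans (hf.reg 5 (by decide))
  have h9₂ : s₂.reg 9 = s.reg 9 := (hf₂.reg 9 (by decide)).trans (hf.reg 9 (by decide))
  have h10₂ : s₂.reg 10 = s.reg 10 := (hf₂.reg 10 (by decide)).trans (hf.reg 10 (by decide))
  have h11₂ : s₂.reg 11 = posDeg G v := (hf₂.reg 11 (by decide)).trans h11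
  rw [h5] at h5₂
  rw [h9] at h9₂
  have hdu := posDeg_le_card (G := G) (u := u)
  have hdv := posDeg_le_card (G := G) (u := v)
  have hcu := commonDeg_le_left (G := G) (u := u) (v := v)
  -- The flag in the shape of the nested tests of `edgePost`.
  have hag : agreeFlag G u v = if 9 * posDeg G u ≤ 10 * commonDeg G u v then
      if 9 * posDeg G v ≤ 10 * commonDeg G u v then 1 else 0 else 0 := by
    rw [agreeFlag, Agree]
    split_ifs <;> first | rfl | omega
  refine Runs.block ?_ (by decide) ?_
  · simp [edgePost, Program.Safe, Program.eval, h9₂, h11₂, hc, Op.eval, he₂.nine,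
      he₂.ten, Test.holds]
    by_cases ha : 9 * posDeg G u ≤ 10 * commonDeg G u v <;>
    by_cases hb : 9 * posDeg G v ≤ 10 * commonDeg G u v <;>
    simp [ha, hb, h5₂, h10₂, he₂.one] <;> omega
  · rw [hag]
    simp only [edgePost, Program.eval, Test.holds, Op.eval]
    by_cases ha : 9 * posDeg G u ≤ 10 * commonDeg G u v <;>
    by_cases hb : 9 * posDeg G v ≤ 10 * commonDeg G u v <;>
    simp [h5₂, h9₂, h10₂, h11₂, hc, he₂.one, he₂.nine, he₂.ten, ha, hb, h4, add_assoc]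

open Classical in
lemma runs_edges (hW : n * n + 20 * n + 60 ≤ W) (hG : IsAdjList G adj) {u : Fin n}
    {s : State} (he : Env adj s) (h5 : s.reg 5 = s.arr 0 u) (h6 : s.reg 6 = s.arr 0 (u + 1))
    (h7 : s.reg 7 = u + 1) (h9 : s.reg 9 = posDeg G u) (h10 : s.reg 10 = 1)
    (hm : ∀ w : Fin n, (s.arr 3 w = u + 1 ↔ w ∈ posNbhd G u) ∧ s.arr 3 w ≤ u + 1) :
    Runs W (.loop (.lt 5 6) edgeBody) s (1 + (adj u).length * (1 + 24 * maxPosDegree G)) fun s' =>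
      Frame edgeBody s s' ∧ s'.reg 10 = (agreeNbhd G u).card ∧
      (∀ x < s.arr 0 u, s'.arr 4 x = s.arr 4 x) ∧
      ∀ t (ht : t < (adj u).length), s'.arr 4 (s.arr 0 u + t) = agreeFlag G u (adj u)[t] := by
  refine (Runs.loop (p := edgeBody) (b := .lt 5 6) (N := (adj u).length)
    (B := 24 * maxPosDegree G)
    (fun t s' => s'.reg 5 = s.arr 0 u + t ∧
      s'.reg 10 = 1 + ((adj u).take t).countP (fun v => decide (Agree G u v)) ∧
      (∀ x < s.arr 0 u, s'.arr 4 x = s.arr 4 x) ∧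
      ∀ t' (ht' : t' < (adj u).length), t' < t →
        s'.arr 4 (s.arr 0 u + t') = agreeFlag G u (adj u)[t'])
    ⟨by simpa using h5, by simpa using h10, fun _ _ => rfl, fun _ _ h => absurd h (by simp)⟩
    ?_ ?_).mono le_rfl ?_
  · rintro t ht s' hf ⟨h1, -⟩
    have h2 := hf.reg 6 (by decide)
    have h3 := he.off_succ u
    simp only [Test.holds]
    omega
  · rintro t ht s' hf ⟨h1, h2, h3, h4⟩
    have h0 := hf.arr 0 (by decide)
    have hc := List.countP_le_length (l := (adj u).take t) (p := fun v => decide (Agree G u v))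
    have hl : ((adj u).take t).length ≤ t := by simp
    have hl' := hG.length_lt u
    refine (runs_edge hW hG ht (he.frame hf (by decide) (by decide)) (by rw [h1, h0])
      (by rw [hf.reg 7 (by decide), h7]) (by rw [hf.reg 9 (by decide), h9]) (by omega)
      (by rw [hf.arr 3 (by decide)]; exact hm)).mono le_rfl ?_
    rintro s'' ⟨h8, h9, h10⟩
    rw [h0] at h8 h10
    refine ⟨h8, ?_, fun x hx => ?_, fun t' ht' htt => ?_⟩
    · rw [h9, h2, List.take_succ_eq_append_getElem ht, List.countP_append, List.countP_singleton,
        agreeFlag]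
      simp [add_assoc]
    · rw [h10, if_neg (by omega), h3 x hx]
    · rw [h10]
      rcases Nat.lt_succ_iff_lt_or_eq.1 htt with h | rfl
      · rw [if_neg (by omega), h4 t' ht' h]
      · rw [if_pos rfl]
  · rintro s' ⟨hf, -, h1, h2, h3⟩
    refine ⟨hf, ?_, h2, fun t ht => h3 t ht ht⟩
    rw [h1, List.take_length, hG.one_add_countP u _ agree_self]
    rfl

/-- Let the registers `5` and `6` delimit the list of the current vertex. -/
def listBounds : Program := .seq (.load 5 0 4) (.seq (.arith .add 7 4 1) (.load 6 0 7))

/-- Compute the degree of the current vertex and stamp the vertex itself. -/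
def vertexPre : Program :=
  .seq listBounds (.seq (.arith .sub 9 6 5) (.seq (.arith .add 9 9 1) (.store 3 4 7)))

/-- Prepare the loop over the neighbours of the current vertex. -/
def vertexMid : Program := .seq (.load 5 0 4) (.const 10 1)

/-- Store in array `5` a name that tells heavy vertices from the others. -/
def vertexPost : Program :=
  .seq (.arith .mul 18 3 10) (.seq (.arith .mul 16 2 9) (.seq (.copy 15 4)
    (.seq (.cond (.le 16 18) .skip (.arith .add 15 15 0))
      (.seq (.store 5 4 15) (.arith .add 4 4 1)))))

/-- Compute the agreement flags of the current vertex and decide whether it is heavy. -/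
def vertexBody : Program :=
  .seq vertexPre (.seq (.loop (.lt 5 6) markBody) (.seq vertexMid
    (.seq (.loop (.lt 5 6) edgeBody) vertexPost)))

open Classical in
variable (G) in
/-- The name of a vertex: heavy vertices have the names below `n`. -/
noncomputable def heavyName (u : Fin n) : ℕ := if Heavy G u then u else n + u

lemma IsAdjList.length_lt_maxPosDegree (hG : IsAdjList G adj) (u : Fin n) :
    (adj u).length < maxPosDegree G := by
  have := hG.posDeg_eq u
  have := posDeg_le_maxPosDegree (G := G) (u := u)
  omega

lemma runs_vertex (hW : n * n + 20 * n + 60 ≤ W) (hG : IsAdjList G adj) {u : Fin n}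
    {s : State} (he : Env adj s) (h4 : s.reg 4 = u) (hm : ∀ w : Fin n, s.arr 3 w ≤ u) :
    Runs W vertexBody s (50 * (maxPosDegree G * maxPosDegree G)) fun s' =>
      s'.reg 4 = u + 1 ∧ (∀ w : Fin n, s'.arr 3 w ≤ u + 1) ∧
      (∀ x < s.arr 0 u, s'.arr 4 x = s.arr 4 x) ∧
      (∀ t (ht : t < (adj u).length), s'.arr 4 (s.arr 0 u + t) = agreeFlag G u (adj u)[t]) ∧
      ∀ x, s'.arr 5 x = if x = u then heavyName G u else s.arr 5 x := by
  have ho := he.off_le hG (i := u + 1) u.2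
  have hs := he.off_succ u
  have hd := hG.posDeg_eq u
  have hl := hG.length_lt u
  have hlD := hG.length_lt_maxPosDegree u
  have hun := u.2
  -- The total cost is 17 + `(adj u).length` · (5 + 24Δ), at most 50Δ² because Δ ≥ 1.
  have hlen : (adj u).length * (5 + 24 * maxPosDegree G) ≤
      maxPosDegree G * (5 + 24 * maxPosDegree G) := Nat.mul_le_mul_right _ hlD.le
  refine (Runs.seq (B := 6) (R := fun s' => Frame vertexPre s s' ∧ s'.reg 5 = s.arr 0 u ∧
    s'.reg 6 = s.arr 0 (u + 1) ∧ s'.reg 7 = u + 1 ∧ s'.reg 9 = posDeg G u ∧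
    ∀ w : Fin n, s'.arr 3 w = if w = u then (u : ℕ) + 1 else s.arr 3 w) ?_ (B' := _) ?_).mono
    (B := 6 + (1 + (adj u).length * (1 + 3) + (2 +
      (1 + (adj u).length * (1 + 24 * maxPosDegree G) + 7)))) (by nlinarith) fun _ h => h
  · refine (Runs.block (B := 6) (Q := fun s' => s'.reg 5 = s.arr 0 u ∧
      s'.reg 6 = s.arr 0 (u + 1) ∧ s'.reg 7 = u + 1 ∧ s'.reg 9 = posDeg G u ∧
      ∀ w : Fin n, s'.arr 3 w = if w = u then (u : ℕ) + 1 else s.arr 3 w) ?_ (by decide) ?_).frame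
    · simp [vertexPre, listBounds, Program.Safe, Program.eval, h4, Op.eval, he.one]
      omega
    · simp [vertexPre, listBounds, Program.eval, h4, Op.eval, he.one, Fin.ext_iff]
      omega
  rintro s₁ ⟨hf₁, h5, h6, h7, h9, h3⟩
  have he₁ := he.frame hf₁ (by decide) (by decide)
  have h0₁ := hf₁.arr 0 (by decide)
  refine Runs.seq (runs_mark hW hG he₁ (by rw [h5, h0₁]) (by rw [h6, h0₁]) h7 fun w => ?_) ?_
  · rw [h3]
    have := hm w
    split_ifs with hw
    · simp [hw]
    · simp only [hw, iff_false]; omega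
  rintro s₂ ⟨hf₂, hm₂⟩
  have he₂ := he₁.frame hf₂ (by decide) (by decide)
  have h0₂ : s₂.arr 0 = s.arr 0 := (hf₂.arr 0 (by decide)).trans h0₁
  have h4₂ : s₂.reg 4 = u := by rw [hf₂.reg 4 (by decide), hf₁.reg 4 (by decide), h4]
  refine Runs.seq (B := 2) (R := fun s' => Frame vertexMid s₂ s' ∧ s'.reg 5 = s.arr 0 u ∧
    s'.reg 10 = 1) (Runs.block ?_ (by decide) ?_).frame ?_
  · simp [vertexMid, Program.Safe, h4₂, h0₂]
    omega
  · simp [vertexMid, Program.eval, h4₂, h0₂]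
  rintro s₃ ⟨hf₃, h5₃, h10⟩
  have he₃ := he₂.frame hf₃ (by decide) (by decide)
  have h0₃ : s₃.arr 0 = s.arr 0 := (hf₃.arr 0 (by decide)).trans h0₂
  have hr : ∀ x, x ∉ vertexMid.modRegs → x ∉ markBody.modRegs → s₃.reg x = s₁.reg x :=
    fun x h h' => (hf₃.reg x h).trans (hf₂.reg x h')
  have ha : ∀ x, x ∉ vertexMid.modArrs → x ∉ markBody.modArrs → x ∉ vertexPre.modArrs →
      s₃.arr x = s.arr x :=
    fun x h h' h'' => (hf₃.arr x h).trans ((hf₂.arr x h').trans (hf₁.arr x h''))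
  refine Runs.seq (runs_edges hW hG (u := u) he₃ (by rw [h5₃, h0₃])
    (by rw [hr 6 (by decide) (by decide), h6, h0₃]) (by rw [hr 7 (by decide) (by decide), h7])
    (by rw [hr 9 (by decide) (by decide), h9]) h10
    (by rw [hf₃.arr 3 (by decide)]; exact hm₂)) ?_
  rintro s₄ ⟨hf₄, h10₄, hlow, hflag⟩
  have he₄ := he₃.frame hf₄ (by decide) (by decide)
  have h3₄ : s₄.arr 3 = s₂.arr 3 := (hf₄.arr 3 (by decide)).trans (hf₃.arr 3 (by decide))
  have h4₄ : s₄.reg 4 = u := by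
    rw [hf₄.reg 4 (by decide), hf₃.reg 4 (by decide), h4₂]
  have h9₄ : s₄.reg 9 = posDeg G u := by
    rw [hf₄.reg 9 (by decide), hr 9 (by decide) (by decide), h9]
  have h5₄ : s₄.arr 5 = s.arr 5 := by
    rw [hf₄.arr 5 (by decide), ha 5 (by decide) (by decide) (by decide)]
  rw [h0₃, ha 4 (by decide) (by decide) (by decide)] at hlow
  rw [h0₃] at hflag
  have hadd := lossDeg_add (G := G) (u := u)
  refine Runs.block ?_ (by decide) ?_
  · simp [vertexPost, Program.Safe, Program.eval, h4₄, h9₄, h10₄, Op.eval, he₄.nine, he₄.ten,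
      Test.holds]
    by_cases hh : 9 * posDeg G u ≤ 10 * (agreeNbhd G u).card <;>
    simp [hh, h4₄, he₄.one, he₄.size] <;> omega
  · rw [heavyName, Heavy]
    simp only [vertexPost, Program.eval, Test.holds, Op.eval]
    by_cases hh : 9 * posDeg G u ≤ 10 * (agreeNbhd G u).card <;>
    simp [hh, h4₄, h9₄, h10₄, h3₄, h5₄, he₄.one, he₄.size, he₄.nine, he₄.ten, add_comm n]
    · exact ⟨fun w => (hm₂ w).2, hlow, hflag⟩
    · exact ⟨fun w => (hm₂ w).2, hlow, hflag⟩

/-- Run a program for every vertex. -/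
def forVertices (p : Program) : Program := .seq (.const 4 0) (.loop (.lt 4 0) p)

lemma runs_forVertices {p : Program} {B : ℕ} (hn : n < W) {s : State} (he : Env adj s)
    (hr : ∀ x < 4, x ∉ p.modRegs) (ha : ∀ a < 2, a ∉ p.modArrs) (I : ℕ → State → Prop)
    (h0 : I 0 (s.setReg 4 0))
    (hstep : ∀ (u : Fin n) (s' : State), Frame p (s.setReg 4 0) s' → Env adj s' →
      s'.reg 4 = u → I u s' → Runs W p s' B fun s' => s'.reg 4 = u + 1 ∧ I (u + 1) s') :
    Runs W (forVertices p) s (2 + n * (1 + B)) fun s' =>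
      (∀ a, a ∉ p.modArrs → s'.arr a = s.arr a) ∧ Env adj s' ∧ I n s' := by
  have he' : Env adj (s.setReg 4 0) := by
    refine he.frame (p := .const 4 0) ⟨fun x hx => ?_, fun _ _ => rfl⟩ (by decide) (by decide)
    simp [Program.modRegs] at hx
    simp [hx]
  refine (Runs.seq (B := 1) (R := fun s' => s' = s.setReg 4 0) (B' := 1 + n * (1 + B))
    (Runs.block (by simp [Program.Safe]; omega) le_rfl rfl) ?_).mono (by omega) fun _ h => h
  rintro _ rfl
  refine (Runs.loop (p := p) (b := .lt 4 0) (N := n) (B := B)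
    (fun i s' => s'.reg 4 = i ∧ I i s') ⟨by simp, h0⟩ ?_ ?_).mono le_rfl ?_
  · rintro i hi s' hf ⟨h1, -⟩
    rw [Test.holds, h1, (he'.frame hf hr ha).size]
  · rintro i hi s' hf ⟨h1, h2⟩
    exact hstep ⟨i, hi⟩ s' hf (he'.frame hf hr ha) h1 h2
  · rintro s' ⟨hf, -, h⟩
    exact ⟨fun a ha => hf.arr a ha, he'.frame hf hr ha, h⟩

/-- Array `4` holds the agreement flags. -/
def HasFlags (G : SimpleGraph (Fin n)) (adj : Fin n → List (Fin n)) (s : State) : Prop :=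
  ∀ (u : Fin n) t (ht : t < (adj u).length), s.arr 4 (s.arr 0 u + t) = agreeFlag G u (adj u)[t]

lemma runs_classify (hW : n * n + 20 * n + 60 ≤ W) (hG : IsAdjList G adj) {s : State}
    (he : Env adj s) (hm : ∀ w : Fin n, s.arr 3 w = 0) :
    Runs W (forVertices vertexBody) s (2 + n * (1 + 50 * (maxPosDegree G * maxPosDegree G)))
      fun s' => Env adj s' ∧ HasFlags G adj s' ∧ ∀ u : Fin n, s'.arr 5 u = heavyName G u := by
  refine (runs_forVertices (W := W) (by omega) he (by decide) (by decide) (fun i s' =>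
    (∀ w : Fin n, s'.arr 3 w ≤ i) ∧
    (∀ u : Fin n, u < i → ∀ t (ht : t < (adj u).length),
      s'.arr 4 (s.arr 0 u + t) = agreeFlag G u (adj u)[t]) ∧
    ∀ u : Fin n, u < i → s'.arr 5 u = heavyName G u) ?_ ?_).mono le_rfl ?_
  · simp [hm]
  · rintro u s' hf he' h4 ⟨h1, h2, h3⟩
    have h0 : s'.arr 0 = s.arr 0 := hf.arr 0 (by decide)
    refine (runs_vertex hW hG he' h4 h1).mono le_rfl ?_
    rintro s'' ⟨h5, h6, h7, h8, h9⟩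
    rw [h0] at h7 h8
    refine ⟨h5, h6, fun v hv t ht => ?_, fun v hv => ?_⟩
    · rcases Nat.lt_succ_iff_lt_or_eq.1 hv with h | h
      · have := he.off_add_length_le h
        rw [h7 _ (by omega), h2 v h t ht]
      · obtain rfl := Fin.ext h
        exact h8 t ht
    · rw [h9]
      rcases Nat.lt_succ_iff_lt_or_eq.1 hv with h | h
      · rw [if_neg h.ne, h3 v h]
      · obtain rfl := Fin.ext h
        rw [if_pos rfl]
  · rintro s' ⟨hf, he', -, h1, h2⟩
    refine ⟨he', fun u t ht => ?_, fun u => h2 u u.2⟩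
    rw [hf 0 (by decide)]
    exact h1 u u.2 t ht

/-! ### Minima over agreeing neighbours -/

/-- Take the minimum with the value in array `a` of the current neighbour, if it agrees with the
current vertex. -/
def minEdge (a : ℕ) : Program :=
  .seq (.load 8 1 5) (.seq (.load 15 4 5)
    (.seq (.cond (.eq 15 1) (.seq (.load 16 a 8) (.cond (.lt 16 10) (.copy 10 16) .skip)) .skip)
      (.arith .add 5 5 1)))

/-- Store in array `b` the minimum of array `a` over the agreeing neighbours of the current
vertex. -/
def minVertex (a b : ℕ) : Program :=
  .seq (.seq listBounds (.load 10 a 4)) (.seq (.loop (.lt 5 6) (minEdge a))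
    (.seq (.store b 4 10) (.arith .add 4 4 1)))

lemma modRegs_minEdge (a : ℕ) : (minEdge a).modRegs = [8, 15, 16, 10, 5] := rfl

lemma modArrs_minEdge (a : ℕ) : (minEdge a).modArrs = [] := rfl

lemma modRegs_minVertex (a b : ℕ) :
    (minVertex a b).modRegs = [5, 7, 6, 10, 8, 15, 16, 10, 5, 4] := rfl

lemma modArrs_minVertex (a b : ℕ) : (minVertex a b).modArrs = [b] := rfl

lemma runs_minEdges (hW : n * n + 20 * n + 60 ≤ W) (hG : IsAdjList G adj) {a : ℕ}
    {f : Fin n → ℕ} (hf : ∀ u, f u ≤ 2 * n) {u : Fin n} {s : State} (he : Env adj s)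
    (hfl : HasFlags G adj s) (ha : ∀ v : Fin n, s.arr a v = f v) (h5 : s.reg 5 = s.arr 0 u)
    (h6 : s.reg 6 = s.arr 0 (u + 1)) (h10 : s.reg 10 = f u) :
    Runs W (.loop (.lt 5 6) (minEdge a)) s (1 + (adj u).length * (1 + 7)) fun s' =>
      Frame (minEdge a) s s' ∧ IsLeast (f '' agreeNbhd G u) (s'.reg 10) := by
  refine (Runs.loop (p := minEdge a) (b := .lt 5 6) (N := (adj u).length) (B := 7)
    (fun t s' => s'.reg 5 = s.arr 0 u + t ∧ s'.reg 10 ∈ f '' agreeNbhd G u ∧ s'.reg 10 ≤ f u ∧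
      ∀ t' (ht' : t' < (adj u).length), t' < t → Agree G u (adj u)[t'] →
        s'.reg 10 ≤ f (adj u)[t'])
    ⟨by simpa using h5, ⟨u, self_mem_agreeNbhd, h10.symm⟩, h10.le,
      fun _ _ h => absurd h (by simp)⟩ ?_ ?_).mono le_rfl ?_
  · rintro t ht s' hf ⟨h1, -⟩
    have h2 := hf.reg 6 (by rw [modRegs_minEdge]; decide)
    have h3 := he.off_succ u
    simp only [Test.holds]
    omega
  · rintro t ht s' hfr ⟨h1, h2, h3, h4⟩
    have hA : ∀ x, s'.arr x = s.arr x := fun x => hfr.arr x (by rw [modArrs_minEdge]; simp)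
    have he' := he.frame hfr (by rw [modRegs_minEdge]; decide) (by rw [modArrs_minEdge]; simp)
    have ho := he.off_le hG (i := u + 1) u.2
    have hs := he.off_succ u
    have h8 := he.nbr u t ht
    have h9 := hfl u t ht
    have hv := ((adj u)[t]).2
    have hfv := hf (adj u)[t]
    have hfu := hf u
    have hmem : Agree G u (adj u)[t] → (adj u)[t] ∈ agreeNbhd G u := fun h =>
      mem_agreeNbhd.2 ⟨hG.mem_posNbhd.2 (.inr (List.getElem_mem ht)), h⟩
    rw [agreeFlag] at h9
    refine Runs.block ?_ (by simp [minEdge, Program.cost]) ?_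
    · simp [minEdge, Program.Safe, Program.eval, h1, hA, h8, h9, ha, Op.eval, he'.one,
        Test.holds]
      by_cases hag : Agree G u (adj u)[t] <;> by_cases hlt : f (adj u)[t] < s'.reg 10 <;>
      simp [hag, hlt, h1, h8, h9, he'.one, hA] <;> omega
    · simp only [minEdge, Program.eval, Test.holds, Op.eval]
      by_cases hag : Agree G u (adj u)[t]
      · by_cases hlt : f (adj u)[t] < s'.reg 10
        · simp [hag, hlt, h1, h8, h9, ha, he'.one, hA, add_assoc]
          refine ⟨⟨_, hmem hag, rfl⟩, by omega, fun t' ht' htt hag' => ?_⟩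
          rcases htt.lt_or_eq with h | rfl
          · exact hlt.le.trans (h4 t' ht' h hag')
          · exact le_rfl
        · simp [hag, hlt, h1, h8, h9, ha, he'.one, hA, add_assoc]
          refine ⟨h2, h3, fun t' ht' htt hag' => ?_⟩
          rcases htt.lt_or_eq with h | rfl
          · exact h4 t' ht' h hag'
          · omega
      · simp [hag, h1, h9, he'.one, hA, add_assoc]
        refine ⟨h2, h3, fun t' ht' htt hag' => ?_⟩
        rcases htt.lt_or_eq with h | rfl
        · exact h4 t' ht' h hag'
        · exact absurd hag' hag
  · rintro s' ⟨hfr, -, h1, h2, h3⟩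
    refine ⟨hfr, h1, ?_⟩
    rintro _ ⟨v, hv, rfl⟩
    obtain ⟨hv, hag⟩ := mem_agreeNbhd.1 hv
    rcases hG.mem_posNbhd.1 hv with rfl | hv
    · exact h2
    · obtain ⟨t, ht, rfl⟩ := List.mem_iff_getElem.1 hv
      exact h3 t ht ht hag

/-- The condition `hb` protects the input and the flags from being overwritten, and `hab` ensures
that all minima are taken of the old values. -/
lemma runs_min (hW : n * n + 20 * n + 60 ≤ W) (hG : IsAdjList G adj) {a b : ℕ} (hb : 5 ≤ b)
    (hab : a ≠ b) {f : Fin n → ℕ} (hf : ∀ u, f u ≤ 2 * n) {s : State} (he : Env adj s)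
    (hfl : HasFlags G adj s) (ha : ∀ v : Fin n, s.arr a v = f v) :
    Runs W (forVertices (minVertex a b)) s (2 + n * (1 + (7 + 8 * maxPosDegree G))) fun s' =>
      (∀ c, c ≠ b → s'.arr c = s.arr c) ∧ Env adj s' ∧
        ∀ u : Fin n, IsLeast (f '' agreeNbhd G u) (s'.arr b u) := by
  refine (runs_forVertices (p := minVertex a b) (by omega) he
    (by rw [modRegs_minVertex]; decide) (by rw [modArrs_minVertex]; simp; omega)
    (fun i s' => ∀ u : Fin n, u < i → IsLeast (f '' agreeNbhd G u) (s'.arr b u))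
    (fun _ h => absurd h (by simp)) ?_).mono le_rfl ?_
  swap
  · rintro s' ⟨h1, h2, h3⟩
    exact ⟨fun c hc => h1 c (by rw [modArrs_minVertex]; simpa using hc), h2, fun u => h3 u u.2⟩
  rintro u s₀ hf₀ he₀ h4 hI
  have hA : ∀ c, c ≠ b → s₀.arr c = s.arr c := fun c hc =>
    hf₀.arr c (by rw [modArrs_minVertex]; simpa using hc)
  have ha₀ : ∀ v : Fin n, s₀.arr a v = f v := fun v => by rw [hA a hab, ha]
  have hfl₀ : HasFlags G adj s₀ := by
    rw [HasFlags, hA 4 (by omega), hA 0 (by omega)]; exact hfl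
  have ho := he₀.off_le hG (i := u + 1) u.2
  have hs := he₀.off_succ u
  have hlD := hG.length_lt_maxPosDegree u
  have hun := u.2
  have hfu := hf u
  refine (Runs.seq (B := 4) (R := fun s' => Frame (.seq listBounds (.load 10 a 4)) s₀ s' ∧
    s'.reg 5 = s₀.arr 0 u ∧ s'.reg 6 = s₀.arr 0 (u + 1) ∧ s'.reg 10 = f u)
    (Runs.block ?_ ?_ ?_).frame (B' := _) ?_).mono
    (B := 4 + (1 + (adj u).length * (1 + 7) + 2)) (by omega) fun _ h => h
  · simp [listBounds, Program.Safe, Program.eval, h4, Op.eval, he₀.one, ha₀]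
    omega
  · simp [listBounds, Program.cost]
  · simp [listBounds, Program.eval, h4, Op.eval, he₀.one, ha₀]
  rintro s₁ ⟨hf₁, h5, h6, h10⟩
  have hr₁ : (Program.seq listBounds (.load 10 a 4)).modRegs = [5, 7, 6, 10] := rfl
  have hA₁ : ∀ c, s₁.arr c = s₀.arr c := fun c =>
    hf₁.arr c (by simp [listBounds, Program.modArrs])
  have he₁ := he₀.frame hf₁ (by rw [hr₁]; decide) (by simp [listBounds, Program.modArrs])
  refine Runs.seq (runs_minEdges hW hG hf (u := u) he₁ (by rw [HasFlags, hA₁, hA₁]; exact hfl₀)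
    (by rw [hA₁]; exact ha₀) (by rw [h5, hA₁]) (by rw [h6, hA₁]) h10) ?_
  rintro s₂ ⟨hf₂, hmin⟩
  have he₂ := he₁.frame hf₂ (by rw [modRegs_minEdge]; decide) (by rw [modArrs_minEdge]; simp)
  have h4₂ : s₂.reg 4 = u := by
    rw [hf₂.reg 4 (by rw [modRegs_minEdge]; decide), hf₁.reg 4 (by rw [hr₁]; decide), h4]
  have hA₂ : s₂.arr b = s₀.arr b := by
    rw [hf₂.arr b (by rw [modArrs_minEdge]; simp), hA₁]
  have hle : s₂.reg 10 ≤ f u := hmin.2 ⟨u, self_mem_agreeNbhd, rfl⟩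
  refine Runs.block ?_ (by simp [Program.cost]) ?_
  · simp [Program.Safe, Program.eval, h4₂, Op.eval, he₂.one]
    omega
  · simp only [Program.eval, h4₂, Op.eval, he₂.one, State.reg_setReg, State.arr_setReg,
      State.reg_setArr, State.arr_setArr, hA₂]
    refine ⟨by simp, fun v hv => ?_⟩
    rcases Nat.lt_succ_iff_lt_or_eq.1 hv with h | h
    · simpa [h.ne] using hI v h
    · obtain rfl := Fin.ext h
      simpa using hmin

/-- Store the label of the current vertex in array `2`. -/
def labelVertex : Program :=
  .seq (.load 15 5 4) (.seq (.load 10 7 4) (.seq (.cond (.le 0 15) (.copy 10 15) .skip)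
    (.seq (.store 2 4 10) (.arith .add 4 4 1))))

lemma runs_label (hW : n * n + 20 * n + 60 ≤ W) {s : State} (he : Env adj s)
    (h5 : ∀ u : Fin n, s.arr 5 u ≤ 2 * n) (h7 : ∀ u : Fin n, s.arr 7 u ≤ 2 * n) :
    Runs W (forVertices labelVertex) s (2 + n * (1 + 6)) fun s' =>
      ∀ u : Fin n, s'.arr 2 u = if n ≤ s.arr 5 u then s.arr 5 u else s.arr 7 u := by
  refine (runs_forVertices (p := labelVertex) (by omega) he (by decide) (by decide)
    (fun i s' => ∀ u : Fin n, u < i →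
      s'.arr 2 u = if n ≤ s.arr 5 u then s.arr 5 u else s.arr 7 u)
    (fun _ h => absurd h (by simp)) ?_).mono le_rfl fun s' h u => h.2.2 u u.2
  rintro u s₀ hf₀ he₀ h4 hI
  have h5₀ : s₀.arr 5 = s.arr 5 := hf₀.arr 5 (by decide)
  have h7₀ : s₀.arr 7 = s.arr 7 := hf₀.arr 7 (by decide)
  have h5u := h5 u
  have h7u := h7 u
  have hun := u.2
  refine Runs.block ?_ (by decide) ?_
  · simp [labelVertex, Program.Safe, Program.eval, h4, h5₀, h7₀, Op.eval, he₀.size, Test.holds]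
    by_cases hle : n ≤ s.arr 5 u <;> simp [hle, h4, he₀.one] <;> omega
  · simp only [labelVertex, Program.eval, Test.holds, Op.eval]
    by_cases hle : n ≤ s.arr 5 u <;> simp [hle, h4, h5₀, h7₀, he₀.one, he₀.size] <;>
    · intro v hv
      rcases hv.lt_or_eq with h | rfl
      · simpa [Fin.val_ne_of_ne h.ne] using hI v h
      · simp [hle]

/-! ### The whole algorithm and the meaning of its labels -/

/-- The clustering algorithm. -/
def clusterProgram : Program :=
  .seq (.seq (.const 1 1) (.seq (.const 2 9) (.const 3 10)))
    (.seq (forVertices vertexBody) (.seq (forVertices (minVertex 5 6))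
      (.seq (forVertices (minVertex 6 7)) (forVertices labelVertex))))

lemma heavyName_le (u : Fin n) : heavyName G u ≤ 2 * n := by
  have := u.2
  rw [heavyName]; split_ifs <;> omega

lemma heavyName_lt_iff {u : Fin n} : heavyName G u < n ↔ Heavy G u := by
  have := u.2
  rw [heavyName]; split_ifs with h <;> simp [h]

/-- Labels computed by two rounds of minima of the names over the agreeing neighbours. -/
structure IsLabelling (G : SimpleGraph (Fin n)) (m l L : Fin n → ℕ) : Prop where
  first : ∀ u, IsLeast (heavyName G '' agreeNbhd G u) (m u)
  second : ∀ u, IsLeast (m '' agreeNbhd G u) (l u)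
  label : ∀ u, L u = if n ≤ heavyName G u then heavyName G u else l u

variable {m l L : Fin n → ℕ}

/-- The two minima are attained at some w agreeing with u and some v agreeing with w. Since u
competes with its own name below n, the winning name is below n, so v is heavy and w witnesses the
link. -/
lemma IsLabelling.exists_linked (h : IsLabelling G m l L) {u : Fin n} (hu : Heavy G u) :
    ∃ v, Linked G u v ∧ L u = v := by
  have hn := heavyName_lt_iff.2 hu
  obtain ⟨w, hw, h1⟩ := (h.second u).1
  obtain ⟨v, hv, h2⟩ := (h.first w).1
  have h3 : m u ≤ heavyName G u := (h.first u).2 ⟨u, self_mem_agreeNbhd, rfl⟩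
  have h4 : l u ≤ m u := (h.second u).2 ⟨u, self_mem_agreeNbhd, rfl⟩
  have h5 : L u = heavyName G v := by rw [h.label, if_neg (by omega), ← h1, ← h2]
  have hv' : Heavy G v := heavyName_lt_iff.1 (by omega)
  refine ⟨v, ⟨hu, hv', w, hw, mem_agreeNbhd_comm.1 hv⟩, ?_⟩
  rw [h5, heavyName, if_pos hv']

lemma IsLabelling.label_le (h : IsLabelling G m l L) {u v : Fin n} (huv : Linked G u v) :
    L u ≤ v := by
  obtain ⟨hu, hv, w, h1, h2⟩ := huv
  have hn := heavyName_lt_iff.2 hu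
  have h3 : m w ≤ heavyName G v := (h.first w).2 ⟨v, mem_agreeNbhd_comm.1 h2, rfl⟩
  have h4 : l u ≤ m w := (h.second u).2 ⟨w, h1, rfl⟩
  rw [h.label, if_neg (by omega)]
  rw [heavyName, if_pos hv] at h3
  exact h4.trans h3

/-- For heavy u the label is the smallest vertex linked to u, and transitivity makes it common to
the class. The other vertices keep the distinct names n + u, which no heavy vertex uses. -/
lemma IsLabelling.label_eq_iff (h : IsLabelling G m l L) (u v : Fin n) :
    L u = L v ↔ u = v ∨ Linked G u v := by
  have key : ∀ {u}, ¬ Heavy G u → L u = n + u := fun {u} hu => by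
    have := mt heavyName_lt_iff.1 hu
    rw [h.label, if_pos (by omega), heavyName, if_neg hu]
  constructor
  · intro huv
    by_cases hu : Heavy G u <;> by_cases hv : Heavy G v
    · obtain ⟨x, h1, h2⟩ := h.exists_linked hu
      obtain ⟨y, h3, h4⟩ := h.exists_linked hv
      obtain rfl : x = y := Fin.ext (by omega)
      exact .inr (h1.trans h3.symm)
    · obtain ⟨x, -, h2⟩ := h.exists_linked hu
      rw [key hv] at huv
      omega
    · obtain ⟨x, -, h2⟩ := h.exists_linked hv
      rw [key hu] at huv
      omega
    · rw [key hu, key hv] at huv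
      exact .inl (Fin.ext (by omega))
  · rintro (rfl | huv)
    · rfl
    · have : ∀ {u v}, Linked G u v → L u ≤ L v := fun {u v} huv => by
        obtain ⟨x, h1, h2⟩ := h.exists_linked huv.2.1
        rw [h2]
        exact h.label_le (huv.trans h1)
      exact le_antisymm (this huv) (this huv.symm)

lemma runs_cluster (hW : n * n + 20 * n + 60 ≤ W) (hG : IsAdjList G adj) :
    Runs W clusterProgram (inputState adj)
      (11 + n * (24 + 50 * (maxPosDegree G * maxPosDegree G) + 16 * maxPosDegree G)) fun s =>
      ∀ u v : Fin n, s.arr 2 u = s.arr 2 v ↔ u = v ∨ Linked G u v := by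
  set D := maxPosDegree G
  have hstart : Runs W (.seq (.const 1 1) (.seq (.const 2 9) (.const 3 10))) (inputState adj) 3
      fun s => Env adj s ∧ ∀ w : Fin n, s.arr 3 w = 0 := by
    refine Runs.block ?_ (by decide) ⟨env_inputState rfl rfl ?_ ?_ ?_ ?_, fun w => ?_⟩
    · simp [Program.Safe]; omega
    all_goals simp [Program.eval, inputState]
  refine (hstart.seq (B' := (2 + n * (1 + 50 * (D * D))) + ((2 + n * (1 + (7 + 8 * D))) +
    ((2 + n * (1 + (7 + 8 * D))) + (2 + n * (1 + 6))))) ?_).mono (by ring_nf; rfl) fun _ h => h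
  rintro s₁ ⟨he₁, h3⟩
  refine Runs.seq (runs_classify hW hG he₁ h3) ?_
  rintro s₂ ⟨he₂, hfl₂, h5⟩
  refine Runs.seq
    (runs_min hW hG (by norm_num) (by norm_num) (heavyName_le (G := G)) he₂ hfl₂ h5) ?_
  rintro s₃ ⟨hA₃, he₃, h6⟩
  have hfl₃ : HasFlags G adj s₃ := by
    rw [HasFlags, hA₃ 4 (by norm_num), hA₃ 0 (by norm_num)]; exact hfl₂
  have hle₃ : ∀ u : Fin n, s₃.arr 6 u ≤ 2 * n := fun u =>
    ((h6 u).2 ⟨u, self_mem_agreeNbhd, rfl⟩).trans (heavyName_le u)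
  refine Runs.seq (runs_min hW hG (by norm_num) (by norm_num) hle₃ he₃ hfl₃ fun _ => rfl) ?_
  rintro s₄ ⟨hA₄, he₄, h7⟩
  have h5₄ : ∀ u : Fin n, s₄.arr 5 u = heavyName G u := fun u => by
    rw [hA₄ 5 (by norm_num), hA₃ 5 (by norm_num), h5]
  refine (runs_label hW he₄ (fun u => by rw [h5₄]; exact heavyName_le u) fun u =>
    ((h7 u).2 ⟨u, self_mem_agreeNbhd, rfl⟩).trans (hle₃ u)).mono le_rfl ?_
  intro s₅ h2
  have hlab : IsLabelling G (fun u : Fin n => s₃.arr 6 u) (fun u : Fin n => s₄.arr 7 u)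
      (fun u : Fin n => s₅.arr 2 u) := ⟨h6, h7, fun u => by rw [h2, h5₄]⟩
  exact hlab.label_eq_iff

end Machine

/-- For n < 2 the logarithm vanishes and the additive constant pays. For n ≥ 2 it is at least 1/2,
so the time O(nΔ²) is absorbed. -/
lemma time_bound_le {n D : ℕ} (hD : D ≤ n) (hD' : 0 < n → 0 < D) :
    ((11 + n * (24 + 50 * (D * D) + 16 * D) : ℕ) : ℝ) ≤
      200 * ((n : ℝ) * D ^ 2 * Real.log n + 1) := by
  rcases Nat.lt_or_ge n 2 with hn | hn
  · interval_cases n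
    · norm_num
    · obtain rfl : D = 1 := by have := hD' one_pos; omega
      norm_num
  · have h1 : 24 + 50 * (D * D) + 16 * D ≤ 90 * (D * D) := by
      have := hD' (by omega)
      nlinarith
    have h2 : (11 + n * (24 + 50 * (D * D) + 16 * D)) ≤ 11 + n * (90 * (D * D)) := by gcongr
    have h3 : (1 / 2 : ℝ) ≤ Real.log n := by
      have := Real.log_two_gt_d9
      have h4 : Real.log 2 ≤ Real.log n := Real.log_le_log (by norm_num) (by exact_mod_cast hn)
      linarith
    have h4 : ((11 + n * (24 + 50 * (D * D) + 16 * D) : ℕ) : ℝ) ≤ 11 + n * (90 * (D * D)) := by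
      exact_mod_cast h2
    have h5 : (n : ℝ) * D ^ 2 * (1 / 2) ≤ n * D ^ 2 * Real.log n := by gcongr
    have h6 : (0 : ℝ) ≤ n * D ^ 2 := by positivity
    nlinarith

end CorrClust

open WordRAM CorrClust in
theorem corollary2 :
    ∃ (P : Program) (k : ℕ) (K C : ℝ),
      ∀ (n : ℕ) (G : SimpleGraph (Fin n)) (adj : Fin n → List (Fin n)), IsAdjList G adj →
        ∃ (T : ℕ) (s : State),
          Exec ((n + 2) ^ k) P (inputState adj) T s ∧
          (T : ℝ) ≤ C * ((n : ℝ) * (maxPosDegree G : ℝ) ^ 2 * Real.log n + 1) ∧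
          ∀ p : ENNReal, 1 ≤ p → ∀ C' : Setoid (Fin n),
            lpCost G p (outputClustering n s) ≤ K * lpCost G p C' := by
  refine ⟨clusterProgram, 7, 807, 200, fun n G adj hG => ?_⟩
  have hW : n * n + 20 * n + 60 ≤ (n + 2) ^ 7 := by
    -- The exponent 7 is 2 for the quadratic offsets plus 5 to absorb the constants, since n + 2 ≥ 2
    -- even for n = 0.
    have : 2 ^ 5 ≤ (n + 2) ^ 5 := Nat.pow_le_pow_left (by omega) 5
    calc n * n + 20 * n + 60 ≤ 2 ^ 5 * (n + 2) ^ 2 := by nlinarith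
      _ ≤ (n + 2) ^ 5 * (n + 2) ^ 2 := Nat.mul_le_mul_right _ this
      _ = (n + 2) ^ 7 := by ring
  obtain ⟨T, s, hE, hT, hs⟩ := runs_cluster hW hG
  refine ⟨T, s, hE, (Nat.cast_le.2 hT).trans (time_bound_le ?_ fun hn => ?_), fun p hp C' => ?_⟩
  · exact Finset.sup_le fun u _ => posDeg_le_card
  · exact posDeg_pos.trans_le (posDeg_le_maxPosDegree (u := ⟨0, hn⟩))
  · exact lpCost_le_of_linked (C := outputClustering n s) (fun u v => hs u v) hp C'
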